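/- **Setting.** Let $\mathcal M$ be a $\mathbb Z$-graded manifold (a smooth manifold with a sheaf of graded algebras locally isomorphic to formal power series, with smooth coefficients, in finitely many graded-commuting variables of nonzero degrees), with a cohomological vector field $Q$, i.e. a graded derivation of $C^\infty(\mathcal M)$ of degree $1$ with $Q^2=0$. Let $\Sigma$ be a smooth manifold and $\mathcal F_\Sigma=\mathrm{Map}(T[1]\Sigma,\mathcal M)$ the space of fields: for a finite-dimensional graded-commutative real algebra $A$, an $A$-point $X$ of $\mathcal F_\Sigma$ is a degree-preserving algebra homomorphism $C^\infty(\mathcal M)\to A\otimes\Omega^\bullet(\Sigma)$, $f\mapsto f(X)$. The cohomological vector field $Q_\Sigma=(d_\Sigma)^{\mathrm{lifted}}+Q^{\mathrm{lifted}}$ on $\mathcal F_\Sigma$ is given by $Q_\Sigma\,(f(X))=d\,(f(X))+(Qf)(X)$. A complex function $O$ on $\mathcal F_\Sigma$ assigns to every $A$-point $X$ an element $O(X)\in\mathbb C\otimes A$, compatibly with degree-preserving algebra homomorphisms $A\to B$, and maps smooth curves of fields to smooth curves; it has degree $0$ if $O(X)\in\mathbb C\otimes A_0$; and $Q_\Sigma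 O=0$ means that $O(X+\eta\,Q_\Sigma X)=O(X)$ for all $A$, all $A$-points $X$ and all $\eta\in A$ of degree $-1$. An *observable* is a degree $0$ function $O$ on $\mathcal F_\Sigma$ with $Q_\Sigma O=0$. **Proposition.** Let $\gamma\colon S^1\to\Sigma$ be a smooth loop, $\mathcal H$ a finite-dimensional complex vector space, and $\hat\Theta'\in C^\infty(\mathcal M)\otimes\mathrm{End}(\mathcal H)$ an element of degree $1$ with $$Q\hat\Theta'+i\,(\hat\Theta')^2=0 .$$ (For instance, $\mathcal H$ is the space of states of a geometric quantization of a symplectic manifold $(\mathcal N,\omega')$ and $\hat\Theta'$ a quantization of the Hamiltonian $\Theta'\in C^\infty(\mathcal M\times\mathcal N)$ of a degree $0$ Hamiltonian $Q$-bundle over $\mathcal M$ with fiber $\mathcal N$.) For a point $p\in S^1$ let $\gamma_p\colon[0,1]\to\Sigma$ run once along $\gamma$ in the positive direction starting at $p$, and write $w(t)\,dt$ for the $1$-form component of $\hat\Theta'(\gamma_p^*X)$. Then the path-ordered exponential $$\mathrm{Pexp}\Big(i\oint_\gamma\hat\Theta'(\gamma^*X)\Big)=\lim_{N\to\infty}\Big(1+\tfrac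 iN w\big(\tfrac{N-1}N\big)\Big)\cdots\Big(1+\tfrac iN w\big(\tfrac1N\big)\Big)\Big(1+\tfrac iN w(0)\Big)\in A\otimes\mathrm{End}(\mathcal H)$$ exists for every $A$-point $X$ of $\mathcal F_\Sigma$; its trace $$O_\gamma(X)=\mathrm{tr}_{\mathcal H}\,\mathrm{Pexp}\Big(i\oint_\gamma\hat\Theta'(\gamma^*X)\Big)$$ does not depend on the starting point $p$; and $O_\gamma$ is an observable: it is a degree $0$ function on $\mathcal F_\Sigma$ and $Q_\Sigma O_\gamma=0$. -/

import Mathlib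

open scoped Manifold ContDiff TensorProduct Topology
open TopologicalSpace

noncomputable section

universe u

/-! ## Graded manifolds and Q-manifolds -/

/-- Smooth real functions on an open subset of a manifold modelled on `ℝᵐ`. -/
abbrev SmoothFun {m : ℕ} {B : Type u} [TopologicalSpace B]
    [ChartedSpace (EuclideanSpace ℝ (Fin m)) B] (V : Opens B) : Type u :=
  ContMDiffMap (𝓡 m) 𝓘(ℝ, ℝ) V ℝ ∞

/-- The weight of the monomial `ξ^I = ξ₀^(I 0) ξ₁^(I 1) ⋯` in variables `ξ i` of degree `wt i`. -/
def monomialWeight {r : ℕ} (wt : Fin r → ℤ) (I : Fin r →₀ ℕ) : ℤ :=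
  ∑ i, (I i : ℤ) * wt i

/-- `ξ^I` is a nonzero monomial: variables of odd degree occur at most once. -/
def IsMonomial {r : ℕ} (wt : Fin r → ℤ) (I : Fin r →₀ ℕ) : Prop :=
  ∀ i, Odd (wt i) → I i ≤ 1

/-- The Koszul sign in `ξ^I ξ^J = ± ξ^(I+J)`. -/
def monomialSign {r : ℕ} (wt : Fin r → ℤ) (I J : Fin r →₀ ℕ) : ℝ :=
  (((∑ i, ∑ j, if j < i then (I i : ℤ) * wt i * ((J j : ℤ) * wt j) else 0).negOnePow : ℤ) : ℝ)

/-- A `ℤ`-graded manifold: a smooth manifold (the body) with a sheaf of `ℤ`-graded algebras that is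
locally isomorphic to formal power series, with smooth coefficients on the body, in
graded-commuting variables `ξ i` of nonzero degrees `wt i`.  Sections over `U` are finite sums of
homogeneous ones, and the sheaf condition is imposed in each degree. -/
structure GradedManifold where
  /-- dimension of the body -/
  dim : ℕ
  /-- the body -/
  body : Type u
  [top : TopologicalSpace body]
  [charted : ChartedSpace (EuclideanSpace ℝ (Fin dim)) body]
  [manifold : IsManifold (𝓡 dim) ∞ body]
  [t2 : T2Space body]
  [secondCountable : SecondCountableTopology body]
  /-- number of coordinates of nonzero degree -/
  r : ℕ
  /-- their degrees -/
  wt : Fin r → ℤ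
  wt_ne : ∀ i, wt i ≠ 0
  /-- sections of the structure sheaf -/
  sec : Opens body → Type u
  [ring : ∀ U, Ring (sec U)]
  [algebra : ∀ U, Algebra ℝ (sec U)]
  /-- homogeneous sections -/
  gr : ∀ U, ℤ → Submodule ℝ (sec U)
  [graded : ∀ U, GradedAlgebra (gr U)]
  /-- restriction -/
  res : ∀ {U V : Opens body}, U ≤ V → sec V →ₐ[ℝ] sec U
  res_mem : ∀ {U V : Opens body} (h : U ≤ V) (n : ℤ) (s : sec V), s ∈ gr V n → res h s ∈ gr U n
  res_refl : ∀ (U : Opens body) (s : sec U), res le_rfl s = s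
  res_res : ∀ {U V W : Opens body} (h : U ≤ V) (h' : V ≤ W) (s : sec W),
    res h (res h' s) = res (h.trans h') s
  glue : ∀ (n : ℤ) {ι : Type u} (U : ι → Opens body) (s : ∀ i, sec (U i)),
    (∀ i, s i ∈ gr (U i) n) →
    (∀ i j, res (inf_le_left : U i ⊓ U j ≤ U i) (s i) =
      res (inf_le_right : U i ⊓ U j ≤ U j) (s j)) →
    ∃! t : sec (iSup U), t ∈ gr (iSup U) n ∧ ∀ i, res (le_iSup U i) t = s i
  /-- Every point has a neighbourhood `U` over which sections are the formal power series
  `∑ c_I ξ^I`; here `coeff V s I` is the coefficient `c_I` of the section `s` over `V ⊆ U`. -/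
  locallyFree : ∀ x : body, ∃ U : Opens body, x ∈ U ∧
    ∃ coeff : ∀ V : Opens body, sec V →ₗ[ℝ] ((Fin r →₀ ℕ) → SmoothFun (m := dim) V),
      (∀ V ≤ U, ∀ n : ℤ, Set.BijOn (coeff V) (gr V n)
        {c | ∀ I, c I ≠ 0 → IsMonomial wt I ∧ monomialWeight wt I = n}) ∧
      (∀ (V W : Opens body) (h : V ≤ W), W ≤ U → ∀ (s : sec W) (I : Fin r →₀ ℕ) (y : V),
        coeff V (res h s) I y = coeff W s I ⟨y, h y.2⟩) ∧
      (∀ V ≤ U, ∀ (s t : sec V) (K : Fin r →₀ ℕ), IsMonomial wt K → ∀ y : V,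
        coeff V (s * t) K y = ∑ p ∈ Finset.HasAntidiagonal.antidiagonal K,
          monomialSign wt p.1 p.2 * (coeff V s p.1 y * coeff V t p.2 y))

attribute [instance] GradedManifold.top GradedManifold.charted GradedManifold.manifold
  GradedManifold.ring GradedManifold.algebra GradedManifold.graded

/-- The algebra `C^∞(M)` of global functions on a graded manifold. -/
abbrev GradedManifold.Fun (M : GradedManifold.{u}) : Type u := M.sec ⊤

/-- A cohomological vector field on a graded manifold: a degree `1` graded derivation `Q` of the
algebra of functions with `Q² = 0`. -/
structure CohomologicalVectorField (M : GradedManifold.{u}) where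
  /-- the derivation -/
  toLin : M.Fun →ₗ[ℝ] M.Fun
  degree_one : ∀ (n : ℤ) (f : M.Fun), f ∈ M.gr ⊤ n → toLin f ∈ M.gr ⊤ (n + 1)
  leibniz : ∀ (n : ℤ) (f g : M.Fun), f ∈ M.gr ⊤ n →
    toLin (f * g) = toLin f * g + (n.negOnePow : ℤ) • (f * toLin g)
  sq_zero : ∀ f, toLin (toLin f) = 0

/-! ## Parameter algebras -/

/-- A finite-dimensional graded-commutative real algebra `A`, viewed as the functions on a graded
point that parametrizes families of fields.  The norm only serves to speak of limits and
derivatives; all norms on `A` are equivalent. -/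
structure ParamAlgebra where
  /-- the underlying algebra -/
  carrier : Type
  [normedRing : NormedRing carrier]
  [normedAlgebra : NormedAlgebra ℝ carrier]
  [finiteDimensional : FiniteDimensional ℝ carrier]
  /-- homogeneous elements -/
  gr : ℤ → Submodule ℝ carrier
  [graded : GradedAlgebra gr]
  comm : ∀ (i j : ℤ) (a b : carrier), a ∈ gr i → b ∈ gr j →
    a * b = ((i * j).negOnePow : ℤ) • (b * a)

attribute [instance] ParamAlgebra.normedRing ParamAlgebra.normedAlgebra
  ParamAlgebra.finiteDimensional ParamAlgebra.graded

instance : CoeSort ParamAlgebra Type := ⟨ParamAlgebra.carrier⟩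

/-- The linear map `a ↦ (-1)^|a| a`. -/
def ParamAlgebra.parity (A : ParamAlgebra) : A →ₗ[ℝ] A :=
  DirectSum.coeLinearMap A.gr ∘ₗ
    DirectSum.lmap (fun n : ℤ => ((n.negOnePow : ℤ) : ℝ) • LinearMap.id) ∘ₗ
      (DirectSum.decomposeLinearEquiv A.gr).toLinearMap

/-! ## Differential forms on the source -/

section Forms

variable {d : ℕ} (S : Type*) [TopologicalSpace S] [ChartedSpace (EuclideanSpace ℝ (Fin d)) S]

/-- (Not necessarily smooth) differential forms on `S` of mixed degree with coefficients in `A`: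
`α k` is the `k`-form component.  In the graded algebra `A ⊗ Ω(S)` the coefficients are written to
the left of the forms. -/
abbrev Form (A : ParamAlgebra) : Type _ :=
  ∀ (k : ℕ) (x : S), TangentSpace (𝓡 d) x [⋀^Fin k]→L[ℝ] A

variable {S}

/-- The expression of a `k`-form in the chart at `x₀`, i.e. its pull-back by the inverse chart. -/
def chartForm {A : ParamAlgebra} {k : ℕ} (α : ∀ x : S, TangentSpace (𝓡 d) x [⋀^Fin k]→L[ℝ] A)
    (x₀ : S) (y : EuclideanSpace ℝ (Fin d)) : EuclideanSpace ℝ (Fin d) [⋀^Fin k]→L[ℝ] A :=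
  (α ((extChartAt (𝓡 d) x₀).symm y)).compContinuousLinearMap
    (mfderiv 𝓘(ℝ, EuclideanSpace ℝ (Fin d)) (𝓡 d) (extChartAt (𝓡 d) x₀).symm y)

/-- Smoothness of a `k`-form: smoothness in all charts. -/
def IsSmoothForm {A : ParamAlgebra} {k : ℕ}
    (α : ∀ x : S, TangentSpace (𝓡 d) x [⋀^Fin k]→L[ℝ] A) : Prop :=
  ∀ x₀ : S, ContDiffOn ℝ ∞ (chartForm α x₀) (extChartAt (𝓡 d) x₀).target

/-- The exterior derivative of a `k`-form, computed at `x` in the chart at `x`. -/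
def extDerivForm {A : ParamAlgebra} {k : ℕ}
    (α : ∀ x : S, TangentSpace (𝓡 d) x [⋀^Fin k]→L[ℝ] A) (x : S) :
    TangentSpace (𝓡 d) x [⋀^Fin (k + 1)]→L[ℝ] A :=
  (extDeriv (chartForm α x) (extChartAt (𝓡 d) x x)).compContinuousLinearMap
    (mfderiv (𝓡 d) 𝓘(ℝ, EuclideanSpace ℝ (Fin d)) (extChartAt (𝓡 d) x) x)

/-- The de Rham differential on `A ⊗ Ω(S)`, with the Koszul sign: `d (a α) = (-1)^|a| a dα`. -/
def deRham {A : ParamAlgebra} (α : Form (d := d) S A) : Form (d := d) S A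
  | 0, _ => 0
  | k + 1, x => (LinearMap.toContinuousLinearMap A.parity).compContinuousAlternatingMap
      (extDerivForm (α k) x)

/-- Multiplication of a form by a constant `η ∈ A` from the left. -/
def constMul {A : ParamAlgebra} (η : A) : Form (d := d) S A →ₗ[ℝ] Form (d := d) S A where
  toFun α k x := (ContinuousLinearMap.mul ℝ A η).compContinuousAlternatingMap (α k x)
  map_add' α α' := by
    funext k x; ext v; simp [mul_add]
  map_smul' c α := by
    funext k x; ext v; simp

/-- The exterior product of alternating maps with values in `A` (a sum over shuffles), without
Koszul sign. -/
def wedge {A : ParamAlgebra} {V : Type*} [AddCommGroup V] [Module ℝ V] [TopologicalSpace V]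
    {k l : ℕ} (α : V [⋀^Fin k]→L[ℝ] A) (β : V [⋀^Fin l]→L[ℝ] A) : V [⋀^Fin (k + l)]→ₗ[ℝ] A :=
  (LinearMap.mul' ℝ A).compAlternatingMap
    ((α.toAlternatingMap.domCoprod β.toAlternatingMap).domDomCongr finSumFinEquiv)

/-- The value on tangent vectors `v` at `x` of the degree `n` component of the product of two forms
in the graded algebra `A ⊗ Ω(S)`; the product is `(a α)(b β) = (-1)^(k |b|) (ab) (α ∧ β)` for a
`k`-form `α`. -/
def formMul {A : ParamAlgebra} (α α' : Form (d := d) S A) (n : ℕ) (x : S)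
    (v : Fin n → TangentSpace (𝓡 d) x) : A :=
  ∑ p ∈ (Finset.HasAntidiagonal.antidiagonal n).attach,
    wedge (α p.1.1 x)
      ((LinearMap.toContinuousLinearMap (A.parity ^ p.1.1)).compContinuousAlternatingMap
        (α' p.1.2 x))
      (v ∘ Fin.cast (Finset.HasAntidiagonal.mem_antidiagonal.1 p.2))

end Forms

/-! ## The space of fields `Map(T[1]S, M)` -/

section Fields

variable {d : ℕ} (S : Type*) [TopologicalSpace S] [ChartedSpace (EuclideanSpace ℝ (Fin d)) S]

/-- An `A`-point of the space of fields `Map(T[1]S, M)`, i.e. a family of graded maps from `T[1]S`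
to `M` parametrized by the graded point of `A`: a degree-preserving homomorphism of algebras
`f ↦ f(X)` from `C^∞(M)` to `A ⊗ Ω(S)`. -/
structure Superfield (M : GradedManifold.{u}) (A : ParamAlgebra) where
  /-- the map `f ↦ f(X)` -/
  toLin : M.Fun →ₗ[ℝ] Form (d := d) S A
  smooth : ∀ (f : M.Fun) (k : ℕ), IsSmoothForm (toLin f k)
  degree : ∀ (n : ℤ) (f : M.Fun), f ∈ M.gr ⊤ n → ∀ (k : ℕ) (x : S)
    (v : Fin k → TangentSpace (𝓡 d) x), toLin f k x v ∈ A.gr (n - k)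
  map_one : ∀ (k : ℕ) (x : S) (v : Fin k → TangentSpace (𝓡 d) x),
    toLin 1 k x v = if k = 0 then 1 else 0
  map_mul : ∀ (f g : M.Fun) (n : ℕ) (x : S) (v : Fin n → TangentSpace (𝓡 d) x),
    toLin (f * g) n x v = formMul (toLin f) (toLin g) n x v

variable {S}

theorem chartForm_add {A : ParamAlgebra} {k : ℕ}
    (α α' : ∀ x : S, TangentSpace (𝓡 d) x [⋀^Fin k]→L[ℝ] A) (x₀ : S) :
    chartForm (α + α') x₀ = chartForm α x₀ + chartForm α' x₀ := by
  funext y; ext v; rfl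

theorem chartForm_smul {A : ParamAlgebra} {k : ℕ} (c : ℝ)
    (α : ∀ x : S, TangentSpace (𝓡 d) x [⋀^Fin k]→L[ℝ] A) (x₀ : S) :
    chartForm (c • α) x₀ = c • chartForm α x₀ := by
  funext y; ext v; rfl

theorem IsSmoothForm.differentiableAt {A : ParamAlgebra} {k : ℕ}
    {α : ∀ x : S, TangentSpace (𝓡 d) x [⋀^Fin k]→L[ℝ] A} (h : IsSmoothForm α) (x : S) :
    DifferentiableAt ℝ (chartForm α x) (extChartAt (𝓡 d) x x) :=
  ((h x).contDiffAt (extChartAt_target_mem_nhds x)).differentiableAt (by simp)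

theorem deRham_add {A : ParamAlgebra} {α α' : Form (d := d) S A}
    (h : ∀ k, IsSmoothForm (α k)) (h' : ∀ k, IsSmoothForm (α' k)) :
    deRham (α + α') = deRham α + deRham α' := by
  funext k x
  cases k with
  | zero => simp [deRham]
  | succ k =>
    have e : extDerivForm ((α + α') k) x = extDerivForm (α k) x + extDerivForm (α' k) x := by
      have := extDeriv_add ((h k).differentiableAt x) ((h' k).differentiableAt x)
      rw [← chartForm_add] at this
      simp only [extDerivForm, Pi.add_apply] at this ⊢
      rw [this]
      rfl
    simp only [deRham, Pi.add_apply]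
    rw [Pi.add_apply] at e
    rw [e]
    ext v
    simp

theorem deRham_smul {A : ParamAlgebra} (c : ℝ) (α : Form (d := d) S A) :
    deRham (c • α) = c • deRham α := by
  funext k x
  cases k with
  | zero => ext v; simp [deRham]
  | succ k =>
    have e : extDerivForm ((c • α) k) x = c • extDerivForm (α k) x := by
      have := extDeriv_smul (x := extChartAt (𝓡 d) x x) c (chartForm (α k) x)
      rw [← chartForm_smul] at this
      simp only [extDerivForm, Pi.smul_apply] at this ⊢
      rw [this]
      rfl
    simp only [deRham, Pi.smul_apply]
    rw [Pi.smul_apply] at e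
    rw [e]
    ext v
    simp

/-- The cohomological vector field `Q_S = d^lifted + Q^lifted` on the space of fields, at the point
`X`: it acts on superfields by `f(X) ↦ d (f(X)) + (Q f)(X)`. -/
def aksz {M : GradedManifold.{u}} (Q : CohomologicalVectorField M) {A : ParamAlgebra}
    (X : Superfield (d := d) S M A) : M.Fun →ₗ[ℝ] Form (d := d) S A where
  toFun f := deRham (X.toLin f) + X.toLin (Q.toLin f)
  map_add' f g := by
    rw [map_add, map_add, map_add, deRham_add (X.smooth f) (X.smooth g)]
    abel
  map_smul' c f := by
    rw [map_smul, map_smul, map_smul, deRham_smul]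
    simp

/-- A smooth curve of superfields. -/
def IsSmoothCurve {M : GradedManifold.{u}} {A : ParamAlgebra}
    (X : ℝ → Superfield (d := d) S M A) : Prop :=
  ∀ (f : M.Fun) (k : ℕ) (x₀ : S),
    ContDiffOn ℝ ∞ (fun z : ℝ × EuclideanSpace ℝ (Fin d) => chartForm ((X z.1).toLin f k) x₀ z.2)
      (Set.univ ×ˢ (extChartAt (𝓡 d) x₀).target)

/-- Classical observables.  A complex functional `O` on the space of fields `Map(T[1]S, M)` is given
by its values `O A X ∈ ℂ ⊗ A` at all `A`-points `X`; here `O` is a formula that makes sense for every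
linear map `C^∞(M) → A ⊗ Ω(S)`.  It is an observable if it is a degree `0` smooth function
annihilated by the cohomological vector field. -/
structure IsObservable {M : GradedManifold.{u}} (Q : CohomologicalVectorField M)
    (O : ∀ A : ParamAlgebra, (M.Fun →ₗ[ℝ] Form (d := d) S A) → ℂ ⊗[ℝ] A) : Prop where
  /-- compatibility with change of parameters -/
  natural : ∀ (A B : ParamAlgebra) (φ : A →ₐ[ℝ] B),
    (∀ (n : ℤ) (a : A), a ∈ A.gr n → φ a ∈ B.gr n) →
    ∀ (X : Superfield (d := d) S M A) (Y : Superfield (d := d) S M B),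
      (∀ f k x v, Y.toLin f k x v = φ (X.toLin f k x v)) →
      O B Y.toLin = LinearMap.lTensor ℂ φ.toLinearMap (O A X.toLin)
  /-- smooth curves of fields are mapped to smooth curves -/
  smooth : ∀ (A : ParamAlgebra) (X : ℝ → Superfield (d := d) S M A), IsSmoothCurve X →
    ∀ l : ℂ ⊗[ℝ] A →ₗ[ℝ] ℝ, ContDiff ℝ ∞ fun s => l (O A (X s).toLin)
  degree_zero : ∀ (A : ParamAlgebra) (X : Superfield (d := d) S M A),
    O A X.toLin ∈ LinearMap.range (LinearMap.lTensor ℂ (A.gr 0).subtype)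
  /-- The derivative along the vector field vanishes: `O (X + η Q_S X) = O X` for every parameter
  `η` of degree `-1` (so `η² = 0`); by Taylor expansion,
  `O (X + η Q_S X) = O X + η (Q_S O)(X)`. -/
  closed : ∀ (A : ParamAlgebra) (X : Superfield (d := d) S M A) (η : A), η ∈ A.gr (-1) →
    O A (X.toLin + constMul η ∘ₗ aksz Q X) = O A X.toLin

end Fields

/-! ## Path-ordered exponentials and the generalized Wilson loop -/

section Wilson

/-- Convergence of a sequence in a finite-dimensional real vector space: all coordinates
converge. -/
def FinTendsto {V : Type*} [AddCommGroup V] [Module ℝ V] (u : ℕ → V) (v : V) : Prop :=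
  ∀ l : V →ₗ[ℝ] ℝ, Filter.Tendsto (fun N => l (u N)) Filter.atTop (𝓝 (l v))

variable {R : Type*} [Ring R] [Algebra ℝ R] [Module ℂ R]

/-- The ordered product `∏_{0 ≤ k < N} (1 + (i/N) w(k/N))`, with later factors on the left. -/
def orderedProduct (w : ℝ → R) (N : ℕ) : R :=
  ((List.range N).map fun k : ℕ =>
    1 + (Complex.I / (N : ℂ)) • w ((k : ℝ) / (N : ℝ))).reverse.prod

open Classical in
/-- The path-ordered exponential of `i ∫₀¹ w(t) dt`: the limit of the ordered products
(`0` if they do not converge). -/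
def pathExp (w : ℝ → R) : R :=
  if h : ∃ W : R, FinTendsto (orderedProduct w) W then h.choose else 0

variable {d : ℕ} {S : Type*} [TopologicalSpace S] [ChartedSpace (EuclideanSpace ℝ (Fin d)) S]
  (H : Type*) [AddCommGroup H] [Module ℂ H]

/-- The loop `γ : S¹ → S` as a path on `[0,1]` that starts at the point `p` of the circle. -/
def loopPath (γ : Circle → S) (p : Circle) (t : ℝ) : S :=
  γ (p * Circle.exp (2 * Real.pi * t))

variable {H}

/-- The coefficient `w(t) ∈ End(H) ⊗ A` of the `1`-form component `w(t) dt` of `Θ(γ^*X)`. -/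
def loopIntegrand {M : GradedManifold.{u}} (Θ : Module.End ℂ H ⊗[ℝ] M.Fun) (γ : Circle → S)
    (p : Circle) (A : ParamAlgebra) (X : M.Fun →ₗ[ℝ] Form (d := d) S A) (t : ℝ) :
    Module.End ℂ H ⊗[ℝ] A :=
  LinearMap.lTensor (Module.End ℂ H)
    { toFun := fun f => X f 1 (loopPath γ p t)
        (fun _ => mfderiv 𝓘(ℝ, ℝ) (𝓡 d) (loopPath γ p) t (1 : ℝ))
      map_add' := fun f g => by simp
      map_smul' := fun c f => by simp } Θ

/-- The trace over `H` of the path-ordered exponential of `i ∮_γ Θ(γ^*X)`, with starting point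
`p`. -/
def wilsonLoop {M : GradedManifold.{u}} (Θ : Module.End ℂ H ⊗[ℝ] M.Fun) (γ : Circle → S)
    (p : Circle) (A : ParamAlgebra) (X : M.Fun →ₗ[ℝ] Form (d := d) S A) : ℂ ⊗[ℝ] A :=
  LinearMap.rTensor A ((LinearMap.trace ℂ H).restrictScalars ℝ)
    (pathExp (loopIntegrand Θ γ p A X))

end Wilson

end

noncomputable section

universe u

/-! ## Ordered products -/

section OrderedProducts

/-! Along the loop, the 1-form component `w` of `Θ(X)` plays the role of a connection and the 0-form
component `b`, of degree 1, that of a gauge parameter. Put `u = i w` and `B = i η b`. Replacing `X`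
by `X + η Q_S X` turns `u` into `u - B' - B u + u B`: the de Rham part of `Q_S` gives the derivative
of `B`, and the equation `QΘ + iΘ² = 0` turns the other part into `-iΘ²`, whose 1-form component is
a multiple of `b w - w b` (`gauge_identity`). As `η` is odd, `B(s) B(t)` and `B(s) u(r) B(t)`
vanish. So `1 - B` and `1 + B` are mutually inverse and the holonomy `W` becomes exactly `(1 - B 1)
W (1 + B 0)` (`eulerLim_gauge`). On a loop `B 1 = B 0`, and the trace is cyclic on elements of
degree 0, hence it does not change.

No differential equation is solved; everything is read off from the ordered products. They form a
Cauchy sequence because a mesh `N` and a mesh `M` are both close to their common refinement `N * M`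
(`UniformFamily.uniformCauchySeqOn`). Perturbing each factor by `o(1/N)` does not affect the limit
(`Continuous.tendsto_descProd`). This gives the gauge formula, where the conjugated factors
telescope, and independence of the starting point, where the shift is rounded to the mesh and the
trace is cyclic.

For smoothness, the derivative of an ordered product is the `ε`-component of an ordered product over
the dual numbers. The derivative of a limit is thus a component of a limit of the same kind, and
induction applies (`contDiff_nat_eulerLim`). Degree and naturality hold for each finite product and
pass to the limit. -/

/-- The product `a (n-1) * ⋯ * a 1 * a 0`. -/
def descProd {R : Type*} [Monoid R] (a : ℕ → R) : ℕ → R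
  | 0 => 1
  | n + 1 => a n * descProd a n

section Monoid

variable {R : Type*} [Monoid R]

theorem descProd_add (a : ℕ → R) (m n : ℕ) :
    descProd a (m + n) = descProd (fun i => a (m + i)) n * descProd a m := by
  induction n with
  | zero => simp [descProd]
  | succ n ih => rw [← add_assoc, descProd, ih, descProd, mul_assoc]

/-- Regrouping into consecutive blocks of length `M`; this is how a refined mesh is compared with a
coarse one. -/
theorem descProd_mul (a : ℕ → R) (M n : ℕ) :
    descProd a (n * M) = descProd (fun j => descProd (fun i => a (j * M + i)) M) n := by
  induction n with
  | zero => simp [descProd]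
  | succ n ih => rw [Nat.succ_mul, descProd_add, ih, descProd]

theorem descProd_succ' (a : ℕ → R) (n : ℕ) :
    descProd a (n + 1) = descProd (fun i => a (i + 1)) n * a 0 := by
  rw [add_comm, descProd_add]
  simp [descProd, add_comm]

theorem descProd_congr {a b : ℕ → R} {n : ℕ} (h : ∀ k < n, a k = b k) :
    descProd a n = descProd b n := by
  induction n with
  | zero => rfl
  | succ n ih =>
    rw [descProd, descProd, h n (by omega), ih fun k hk => h k (by omega)]

theorem descProd_mem {σ : Type*} [SetLike σ R] [SubmonoidClass σ R] {s : σ} {a : ℕ → R}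
    (h : ∀ k, a k ∈ s) (n : ℕ) : descProd a n ∈ s := by
  induction n with
  | zero => exact one_mem s
  | succ n ih => exact mul_mem (h n) ih

/-- Cyclic invariance of a trace evaluated on the product of a periodic sequence. -/
theorem trace_descProd_shift {V σ : Type*} [SetLike σ R] [SubmonoidClass σ R] {s : σ} {T : R → V}
    (hT : ∀ x ∈ s, ∀ y ∈ s, T (x * y) = T (y * x)) {a : ℕ → R} (ha : ∀ k, a k ∈ s) {N : ℕ}
    (hN : ∀ k, a (k + N) = a k) (j : ℕ) :
    T (descProd (fun k => a (k + j)) N) = T (descProd a N) := by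
  induction j with
  | zero => rfl
  | succ j ih =>
    rw [← ih]
    cases N with
    | zero => rfl
    | succ m =>
      -- The rightmost factor `a j` of the product shifted by `j` is cycled to the left end, where
      -- periodicity identifies it with `a (j + (m + 1))`, the leftmost factor of the product
      -- shifted by `j + 1`.
      rw [descProd_succ' (fun k => a (k + j)), descProd,
        hT _ (descProd_mem (fun _ => ha _) _) _ (ha _), zero_add,
        show m + (j + 1) = j + (m + 1) by omega, hN]
      simp only [add_assoc, add_comm 1]

end Monoid

/-! ### Norm estimates for ordered products of factors near 1. -/

variable {R : Type*} [NormedRing R]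

/-- The factor `‖1‖` is carried along because the norm of a `NormedRing` need not be normalized at
1. -/
theorem norm_descProd_le {x : ℕ → R} {c : ℝ} {n : ℕ} (hx : ∀ k < n, ‖x k‖ ≤ c) :
    ‖descProd (fun k => 1 + x k) n‖ ≤ ‖(1 : R)‖ * (1 + c) ^ n := by
  induction n with
  | zero => simp [descProd]
  | succ n ih =>
    have ih := ih fun k hk => hx k (by omega)
    have hn := hx n (by omega)
    have hc : 0 ≤ c := (norm_nonneg _).trans hn
    rw [descProd, add_mul, one_mul]
    calc _ ≤ ‖descProd (fun k => 1 + x k) n‖ + ‖x n‖ * ‖descProd (fun k => 1 + x k) n‖ :=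
          (norm_add_le _ _).trans (by gcongr; exact norm_mul_le _ _)
      _ ≤ ‖(1 : R)‖ * (1 + c) ^ n + c * (‖(1 : R)‖ * (1 + c) ^ n) := by gcongr
      _ = _ := by ring

/-- Telescoping: exchanging the factors one at a time costs `δ` each, times a bound on the remaining
product. -/
theorem norm_descProd_sub_le {x y : ℕ → R} {c δ : ℝ} {n : ℕ} (hx : ∀ k < n, ‖x k‖ ≤ c)
    (hy : ∀ k < n, ‖y k‖ ≤ c) (hxy : ∀ k < n, ‖x k - y k‖ ≤ δ) :
    ‖descProd (fun k => 1 + x k) n - descProd (fun k => 1 + y k) n‖ ≤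
      n * δ * (‖(1 : R)‖ * (1 + c) ^ n) := by
  induction n with
  | zero => simp [descProd]
  | succ n ih =>
    have ih := ih (fun k hk => hx k (by omega)) (fun k hk => hy k (by omega))
      (fun k hk => hxy k (by omega))
    have hxn := hx n (by omega)
    have hdn := hxy n (by omega)
    have hc : 0 ≤ c := (norm_nonneg _).trans hxn
    have hδ : 0 ≤ δ := (norm_nonneg _).trans hdn
    have hB := norm_descProd_le (n := n) fun k hk => hy k (by omega)
    rw [descProd, descProd]
    set P := descProd (fun k => 1 + x k) n
    set P' := descProd (fun k => 1 + y k) n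
    have e : (1 + x n) * P - (1 + y n) * P' = (P - P') + x n * (P - P') + (x n - y n) * P' := by
      noncomm_ring
    rw [e]
    calc _ ≤ ‖P - P'‖ + ‖x n‖ * ‖P - P'‖ + ‖x n - y n‖ * ‖P'‖ :=
          (norm_add₃_le).trans (by gcongr <;> exact norm_mul_le _ _)
      _ ≤ n * δ * (‖(1 : R)‖ * (1 + c) ^ n) + c * (n * δ * (‖(1 : R)‖ * (1 + c) ^ n))
          + δ * (‖(1 : R)‖ * (1 + c) ^ n) := by gcongr
      _ ≤ n * δ * (‖(1 : R)‖ * (1 + c) ^ n) + c * (n * δ * (‖(1 : R)‖ * (1 + c) ^ n))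
          + δ * (‖(1 : R)‖ * (1 + c) ^ n) * (1 + c) := by
            refine add_le_add le_rfl ?_
            exact le_mul_of_one_le_right (by positivity) (by linarith)
      _ = _ := by push_cast; ring

theorem norm_descProd_sub_one_le {x : ℕ → R} {c : ℝ} {n : ℕ} (hc : 0 ≤ c)
    (hx : ∀ k < n, ‖x k‖ ≤ c) :
    ‖descProd (fun k => 1 + x k) n - 1‖ ≤ n * c * (‖(1 : R)‖ * (1 + c) ^ n) := by
  have h := norm_descProd_sub_le (y := fun _ => 0) hx (by simpa using fun _ _ => hc)
    (by simpa using hx)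
  have e : descProd (fun _ : ℕ => 1 + (0 : R)) n = 1 := by
    clear h hx
    induction n with
    | zero => rfl
    | succ n ih => rw [descProd, ih]; simp
  rwa [e] at h

/-- To first order a block of factors near `1 + z` is the single factor `1 + n z`. The error
consists of the oscillation `δ` of the `y k` and of the quadratic terms. -/
theorem norm_descProd_sub_linear_le {y : ℕ → R} {z : R} {c δ : ℝ} {n : ℕ} (hc : 0 ≤ c)
    (hy : ∀ k < n, ‖y k‖ ≤ c) (hz : ∀ k < n, ‖y k - z‖ ≤ δ) :
    ‖descProd (fun k => 1 + y k) n - (1 + (n : ℕ) • z)‖ ≤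
      n * (δ + c * (n * c * (‖(1 : R)‖ * (1 + c) ^ n))) := by
  have key : ∀ m ≤ n, ‖descProd (fun k => 1 + y k) m - (1 + (m : ℕ) • z)‖ ≤
      m * (δ + c * (n * c * (‖(1 : R)‖ * (1 + c) ^ n))) := by
    intro m
    induction m with
    | zero => simp [descProd]
    | succ m ih =>
      intro hm
      have ih := ih (by omega)
      have h1 := norm_descProd_sub_one_le (n := m) hc fun k hk => hy k (by omega)
      have h2 : m * c * (‖(1 : R)‖ * (1 + c) ^ m) ≤ n * c * (‖(1 : R)‖ * (1 + c) ^ n) := by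
        have : m ≤ n := by omega
        gcongr
        linarith
      have hym := hy m (by omega)
      have hzm := hz m (by omega)
      rw [descProd]
      set P := descProd (fun k => 1 + y k) m
      have e : (1 + y m) * P - (1 + (m + 1) • z) =
          (P - (1 + m • z)) + (y m - z) + y m * (P - 1) := by
        rw [add_smul, one_smul]; noncomm_ring
      rw [e]
      calc _ ≤ ‖P - (1 + m • z)‖ + ‖y m - z‖ + ‖y m‖ * ‖P - 1‖ :=
            (norm_add₃_le).trans (by gcongr; exact norm_mul_le _ _)
        _ ≤ m * (δ + c * (n * c * (‖(1 : R)‖ * (1 + c) ^ n))) + δ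
            + c * (n * c * (‖(1 : R)‖ * (1 + c) ^ n)) := by
              gcongr
              exact h1.trans h2
        _ = _ := by push_cast; ring
  exact key n le_rfl

end OrderedProducts

/-! ## Euler products of a path in a normed algebra -/

section EulerProducts

/-- The product `∏_{0 ≤ k < N} (1 + u(k/N)/N)`, with later factors on the left. -/
def eulerProd {R : Type*} [Ring R] [Algebra ℝ R] (u : ℝ → R) (N : ℕ) : R :=
  descProd (fun k : ℕ => 1 + (N : ℝ)⁻¹ • u ((k : ℝ) / N)) N

theorem one_add_div_pow_le_exp {C : ℝ} (hC : 0 ≤ C) (N : ℕ) : (1 + C / N) ^ N ≤ Real.exp C := by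
  rcases Nat.eq_zero_or_pos N with rfl | hN
  · simpa using hC
  · have hN' : (N : ℝ) ≠ 0 := by positivity
    calc (1 + C / N) ^ N ≤ (Real.exp (C / N)) ^ N := by
          gcongr
          linarith [Real.add_one_le_exp (C / N)]
      _ = Real.exp C := by rw [← Real.exp_nat_mul]; congr 1; field_simp

theorem natCast_div_mem_Icc {k N : ℕ} (h : k ≤ N) : (k : ℝ) / N ∈ Set.Icc (0 : ℝ) 1 :=
  ⟨by positivity, div_le_one_of_le₀ (by exact_mod_cast h) (by positivity)⟩

variable {R : Type*} [NormedRing R]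

/-- A family of paths on `[0,1]` that is uniformly bounded and uniformly equicontinuous. -/
structure UniformFamily {T : Type*} (u : T → ℝ → R) (K : Set T) : Prop where
  bounded : ∃ C, 0 ≤ C ∧ ∀ s ∈ K, ∀ t ∈ Set.Icc (0 : ℝ) 1, ‖u s t‖ ≤ C
  equicontinuous : ∀ ε > 0, ∃ δ > 0, ∀ s ∈ K, ∀ t ∈ Set.Icc (0 : ℝ) 1, ∀ t' ∈ Set.Icc (0 : ℝ) 1,
    |t - t'| ≤ δ → ‖u s t - u s t'‖ ≤ ε

theorem UniformFamily.of_continuous {T : Type*} [PseudoMetricSpace T] {u : T → ℝ → R} {K : Set T}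
    (hK : IsCompact K) (hu : Continuous fun z : T × ℝ => u z.1 z.2) : UniformFamily u K := by
  have hc : IsCompact (K ×ˢ Set.Icc (0 : ℝ) 1) := hK.prod isCompact_Icc
  constructor
  · obtain ⟨C, hC⟩ := hc.exists_bound_of_continuousOn hu.continuousOn
    exact ⟨max C 0, le_max_right _ _, fun s hs t ht => (hC (s, t) ⟨hs, ht⟩).trans (le_max_left _ _)⟩
  · intro ε hε
    have h := hc.uniformContinuousOn_of_continuous hu.continuousOn
    rw [Metric.uniformContinuousOn_iff_le] at h
    obtain ⟨δ, hδ, h⟩ := h ε hε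
    refine ⟨δ, hδ, fun s hs t ht t' ht' htt => ?_⟩
    have := h (s, t) ⟨hs, ht⟩ (s, t') ⟨hs, ht'⟩ (by
      rw [Prod.dist_eq, dist_self, Real.dist_eq]; exact max_le hδ.le htt)
    rwa [dist_eq_norm] at this

theorem Continuous.uniformFamily {u : ℝ → R} (hu : Continuous u) :
    UniformFamily (fun _ : Unit => u) Set.univ :=
  .of_continuous isCompact_univ (by fun_prop)

variable [NormedAlgebra ℝ R]

/-- There are `N` factors, each off by `ε / N`, and all partial products are bounded by a constant
multiple of `exp (C + 1)` independently of `N`. -/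
theorem norm_descProd_sub_eulerProd_le {u : ℝ → R} {C ε : ℝ} {a : ℕ → R} {N : ℕ} (hC : 0 ≤ C)
    (hε : 0 ≤ ε) (hε1 : ε ≤ 1) (hu : ∀ t ∈ Set.Icc (0 : ℝ) 1, ‖u t‖ ≤ C)
    (ha : ∀ k < N, ‖a k - (1 + (N : ℝ)⁻¹ • u ((k : ℝ) / N))‖ ≤ ε / N) :
    ‖descProd a N - eulerProd u N‖ ≤ ε * (‖(1 : R)‖ * Real.exp (C + 1)) := by
  rcases Nat.eq_zero_or_pos N with rfl | hN
  · simpa [descProd, eulerProd] using by positivity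
  have hN' : (0 : ℝ) < N := by exact_mod_cast hN
  have hy : ∀ k < N, ‖(N : ℝ)⁻¹ • u ((k : ℝ) / N)‖ ≤ C / N := fun k hk => by
    rw [norm_smul, norm_inv, Real.norm_natCast, inv_mul_eq_div]
    gcongr
    exact hu _ (natCast_div_mem_Icc hk.le)
  have ha' : ∀ k < N, ‖(a k - 1) - (N : ℝ)⁻¹ • u ((k : ℝ) / N)‖ ≤ ε / N := fun k hk => by
    rw [sub_sub]; exact ha k hk
  have hx : ∀ k < N, ‖a k - 1‖ ≤ (C + 1) / N := fun k hk => by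
    calc ‖a k - 1‖ = ‖((a k - 1) - (N : ℝ)⁻¹ • u ((k : ℝ) / N)) + (N : ℝ)⁻¹ • u ((k : ℝ) / N)‖ := by
          rw [sub_add_cancel]
      _ ≤ ε / N + C / N := (norm_add_le _ _).trans (add_le_add (ha' k hk) (hy k hk))
      _ ≤ 1 / N + C / N := by gcongr
      _ = _ := by ring
  have h := norm_descProd_sub_le hx
    (fun k hk => (hy k hk).trans (by gcongr; linarith)) ha'
  simp only [add_sub_cancel] at h
  refine h.trans ?_
  rw [mul_div_cancel₀ _ hN'.ne']
  gcongr
  exact one_add_div_pow_le_exp (by linarith) N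

/-- Each block of `M` fine factors is replaced by one coarse factor. In the error, `ε` is the
oscillation of `u` on a coarse step and the term with `C ^ 2` comes from the quadratic terms within
a block; the bound is independent of `M`. -/
theorem norm_eulerProd_mul_sub_le {u : ℝ → R} {C ε : ℝ} {N M : ℕ} (hC : 0 ≤ C) (hε : 0 ≤ ε)
    (hN : 0 < N) (hM : 0 < M) (hu : ∀ t ∈ Set.Icc (0 : ℝ) 1, ‖u t‖ ≤ C)
    (hu' : ∀ t ∈ Set.Icc (0 : ℝ) 1, ∀ t' ∈ Set.Icc (0 : ℝ) 1, |t - t'| ≤ 1 / N →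
      ‖u t - u t'‖ ≤ ε)
    (h1 : ε + ‖(1 : R)‖ * C ^ 2 * Real.exp C / N ≤ 1) :
    ‖eulerProd u (N * M) - eulerProd u N‖ ≤
      (ε + ‖(1 : R)‖ * C ^ 2 * Real.exp C / N) * (‖(1 : R)‖ * Real.exp (C + 1)) := by
  have hN' : (0 : ℝ) < N := by exact_mod_cast hN
  have hM' : (0 : ℝ) < M := by exact_mod_cast hM
  have hN1 : (1 : ℝ) ≤ N := by exact_mod_cast hN
  rw [show eulerProd u (N * M) = descProd (fun j => descProd (fun i =>
    1 + ((N * M : ℕ) : ℝ)⁻¹ • u (((j * M + i : ℕ) : ℝ) / (N * M : ℕ))) M) N from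
    descProd_mul _ _ _]
  refine norm_descProd_sub_eulerProd_le hC (by positivity) h1 hu fun j hj => ?_
  have hmem : ∀ i < M, ((j * M + i : ℕ) : ℝ) / (N * M : ℕ) ∈ Set.Icc (0 : ℝ) 1 := fun i hi =>
    natCast_div_mem_Icc (by nlinarith)
  have h2 := norm_descProd_sub_linear_le (n := M) (c := C / (N * M)) (δ := ε / (N * M))
    (y := fun i => ((N * M : ℕ) : ℝ)⁻¹ • u (((j * M + i : ℕ) : ℝ) / (N * M : ℕ)))
    (z := ((N * M : ℕ) : ℝ)⁻¹ • u ((j : ℝ) / N)) (by positivity)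
    (fun i hi => by
      rw [norm_smul, norm_inv, Real.norm_natCast, inv_mul_eq_div]
      push_cast
      gcongr
      have := hu _ (hmem i hi)
      push_cast at this
      exact this)
    (fun i hi => by
      rw [← smul_sub, norm_smul, norm_inv, Real.norm_natCast, inv_mul_eq_div, Nat.cast_mul]
      gcongr
      have := hu' _ (hmem i hi) _ (natCast_div_mem_Icc hj.le) (by
        have hi' : (i : ℝ) ≤ M := by exact_mod_cast hi.le
        have : ((j * M + i : ℕ) : ℝ) / (N * M : ℕ) - j / N = i / (N * M) := by
          push_cast; field_simp; ring
        rw [this, abs_of_nonneg (by positivity), div_le_div_iff₀ (by positivity) hN']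
        nlinarith)
      rwa [Nat.cast_mul] at this)
  have e : (M : ℕ) • (((N * M : ℕ) : ℝ)⁻¹ • u ((j : ℝ) / N)) = (N : ℝ)⁻¹ • u ((j : ℝ) / N) := by
    rw [← Nat.cast_smul_eq_nsmul ℝ, smul_smul]
    congr 1
    push_cast; field_simp
  rw [e] at h2
  refine h2.trans ?_
  have h3 : (1 + C / (N * M)) ^ M ≤ Real.exp C := by
    calc (1 + C / (N * M)) ^ M = (1 + (C / N) / M) ^ M := by rw [div_div]
      _ ≤ Real.exp (C / N) := one_add_div_pow_le_exp (by positivity) M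
      _ ≤ Real.exp C := Real.exp_le_exp.2 (div_le_self hC hN1)
  calc _ ≤ M * (ε / (N * M) + C / (N * M) * (M * (C / (N * M)) * (‖(1 : R)‖ * Real.exp C))) := by
        gcongr
    _ = _ := by field_simp

/-- Meshes `N` and `M` are each compared with `N * M`. The constants depend only on the common bound
and modulus of continuity, so the estimate is uniform over `K`. -/
theorem UniformFamily.uniformCauchySeqOn {T : Type*} {u : T → ℝ → R} {K : Set T}
    (hu : UniformFamily u K) :
    UniformCauchySeqOn (fun N s => eulerProd (u s) N) Filter.atTop K := by
  obtain ⟨C, hC, hb⟩ := hu.bounded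
  rw [Metric.uniformCauchySeqOn_iff]
  intro ε hε
  set D : ℝ := ‖(1 : R)‖ * Real.exp (C + 1) with hD
  set F : ℝ := ‖(1 : R)‖ * C ^ 2 * Real.exp C with hF
  have hD0 : 0 ≤ D := by positivity
  have hF0 : 0 ≤ F := by positivity
  -- The bound `1 / 2` makes `η + F / N ≤ 1`, as the refinement estimate requires; the other bound
  -- makes each comparison cost at most `ε / 4`. The `+ 1` keeps the denominator positive.
  set η : ℝ := min (1 / 2) (ε / (8 * (D + 1))) with hη
  have hη0 : 0 < η := by positivity
  obtain ⟨δ, hδ, hd⟩ := hu.equicontinuous η hη0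
  obtain ⟨N₀, hN₀⟩ := exists_nat_gt (max (1 / δ) (F / η))
  have hlt1 : 1 / δ < N₀ := (le_max_left _ _).trans_lt hN₀
  have hlt2 : F / η < N₀ := (le_max_right _ _).trans_lt hN₀
  have hN₀0 : (0 : ℝ) < N₀ := lt_of_le_of_lt (by positivity) hlt1
  have key : ∀ N ≥ N₀, ∀ M ≥ N₀, ∀ s ∈ K,
      ‖eulerProd (u s) (N * M) - eulerProd (u s) N‖ ≤ ε / 4 := by
    intro N hN M hM s hs
    have hNr : (N₀ : ℝ) ≤ N := by exact_mod_cast hN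
    have hN0 : (0 : ℝ) < N := hN₀0.trans_le hNr
    have hM0 : (0 : ℝ) < M := hN₀0.trans_le (by exact_mod_cast hM)
    have h1 : (1 : ℝ) / N ≤ δ := by
      rw [div_le_iff₀ hN0]
      rw [div_lt_iff₀ hδ] at hlt1
      nlinarith
    have h2 : F / N ≤ η := by
      rw [div_le_iff₀ hN0]
      rw [div_lt_iff₀ hη0] at hlt2
      nlinarith
    have h3 : η ≤ 1 / 2 := min_le_left _ _
    have h4 : η ≤ ε / (8 * (D + 1)) := min_le_right _ _
    refine (norm_eulerProd_mul_sub_le hC hη0.le (by exact_mod_cast hN0) (by exact_mod_cast hM0)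
      (hb s hs) (fun t ht t' ht' htt => hd s hs t ht t' ht' (htt.trans h1))
      (by linarith)).trans ?_
    calc (η + F / N) * D ≤ (2 * η) * (D + 1) := by gcongr <;> linarith
      _ ≤ (2 * (ε / (8 * (D + 1)))) * (D + 1) := by gcongr
      _ = ε / 4 := by field_simp; norm_num
  refine ⟨N₀, fun N hN M hM s hs => ?_⟩
  rw [dist_eq_norm]
  have k1 := key N hN M hM s hs
  have k2 := key M hM N hN s hs
  rw [mul_comm M N] at k2
  calc ‖eulerProd (u s) N - eulerProd (u s) M‖
      = ‖(eulerProd (u s) (N * M) - eulerProd (u s) M)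
          - (eulerProd (u s) (N * M) - eulerProd (u s) N)‖ := by congr 1; abel
    _ ≤ ε / 4 + ε / 4 := (norm_sub_le _ _).trans (add_le_add k2 k1)
    _ < ε := by linarith

/-- The limit of the Euler products of a path. -/
def eulerLim (u : ℝ → R) : R := Filter.limUnder Filter.atTop (eulerProd u)

variable [CompleteSpace R]

theorem UniformFamily.tendsto_eulerLim {T : Type*} {u : T → ℝ → R} {K : Set T}
    (hu : UniformFamily u K) {s : T} (hs : s ∈ K) :
    Filter.Tendsto (eulerProd (u s)) Filter.atTop (𝓝 (eulerLim (u s))) :=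
  (hu.uniformCauchySeqOn.cauchySeq hs).tendsto_limUnder

theorem UniformFamily.tendstoUniformlyOn {T : Type*} {u : T → ℝ → R} {K : Set T}
    (hu : UniformFamily u K) :
    TendstoUniformlyOn (fun N s => eulerProd (u s) N) (fun s => eulerLim (u s)) Filter.atTop K :=
  hu.uniformCauchySeqOn.tendstoUniformlyOn_of_tendsto fun _ hs => hu.tendsto_eulerLim hs

theorem Continuous.tendsto_eulerLim {u : ℝ → R} (hu : Continuous u) :
    Filter.Tendsto (eulerProd u) Filter.atTop (𝓝 (eulerLim u)) :=
  hu.uniformFamily.tendsto_eulerLim (s := ()) trivial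

/-- Sequences of products whose factors are uniformly `o(1/N)`-close to those of the Euler products
have the same limit. -/
theorem Continuous.tendsto_descProd {u : ℝ → R} (hu : Continuous u) {a : ℕ → ℕ → R}
    (ha : ∀ ε > 0, ∀ᶠ N : ℕ in Filter.atTop, ∀ k < N,
      ‖a N k - (1 + (N : ℝ)⁻¹ • u ((k : ℝ) / N))‖ ≤ ε / N) :
    Filter.Tendsto (fun N => descProd (a N) N) Filter.atTop (𝓝 (eulerLim u)) := by
  obtain ⟨C, hC, hb⟩ := hu.uniformFamily.bounded
  have hz : Filter.Tendsto (fun N => descProd (a N) N - eulerProd u N) Filter.atTop (𝓝 0) := by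
    rw [Metric.tendsto_atTop']
    intro ε hε
    set D : ℝ := ‖(1 : R)‖ * Real.exp (C + 1)
    have hD0 : 0 ≤ D := by positivity
    set η : ℝ := min 1 (ε / (2 * (D + 1)))
    have hη : 0 < η := by positivity
    obtain ⟨N₀, h⟩ := Filter.eventually_atTop.1 (ha η hη)
    refine ⟨N₀, fun N hN => ?_⟩
    rw [dist_zero_right]
    calc _ ≤ η * D := norm_descProd_sub_eulerProd_le hC hη.le (min_le_left _ _)
          (hb () trivial) (h N hN.le)
      _ ≤ (ε / (2 * (D + 1))) * (D + 1) := by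
          gcongr
          · exact min_le_right _ _
          · linarith
      _ = ε / 2 := by field_simp
      _ < ε := by linarith
  simpa using hz.add hu.tendsto_eulerLim

end EulerProducts

/-! ### Gauge transformations and cyclic shifts of Euler products. -/

section Gauge

variable {R : Type*} [NormedRing R] [NormedAlgebra ℝ R]

/-- The mean value inequality for `s ↦ B s - s B'(t)`, whose derivative is small by uniform
continuity of `B'` on `[0,1]`. -/
theorem exists_uniform_taylor {B B' : ℝ → R} (hB : ∀ t, HasDerivAt B (B' t) t)
    (hB' : Continuous B') {ε : ℝ} (hε : 0 < ε) :
    ∃ δ > 0, ∀ t ∈ Set.Icc (0 : ℝ) 1, ∀ h, 0 ≤ h → h ≤ δ → t + h ≤ 1 →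
      ‖B (t + h) - B t - h • B' t‖ ≤ ε * h := by
  obtain ⟨δ, hδ, hd⟩ := hB'.uniformFamily.equicontinuous ε hε
  refine ⟨δ, hδ, fun t ht h hh hhδ hth => ?_⟩
  have hderiv : ∀ s ∈ Set.Icc t (t + h), HasDerivWithinAt (fun s => B s - s • B' t)
      (B' s - B' t) (Set.Icc t (t + h)) s := fun s _ => by
    have := (hB s).sub ((hasDerivAt_id s).smul_const (B' t))
    rw [one_smul] at this
    exact this.hasDerivWithinAt
  have := (convex_Icc t (t + h)).norm_image_sub_le_of_norm_hasDerivWithin_le hderiv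
    (fun s hs => hd () trivial s ⟨ht.1.trans hs.1, hs.2.trans hth⟩ t ht
      (by rw [abs_of_nonneg (by linarith [hs.1])]; linarith [hs.2]))
    (Set.left_mem_Icc.2 (by linarith)) (Set.right_mem_Icc.2 (by linarith))
  rw [add_sub_cancel_left, Real.norm_of_nonneg hh] at this
  rwa [add_smul, sub_sub, show t • B' t + h • B' t + (B t - t • B' t) = B t + h • B' t by abel,
    ← sub_sub] at this

/-- Adjacent gauge factors cancel, leaving only those at the two ends. -/
theorem descProd_gauge {R : Type*} [Ring R] {a g g' : ℕ → R} (h : ∀ k, g' k * g k = 1)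
    (h' : ∀ k, g k * g' k = 1) (n : ℕ) :
    descProd (fun k => g (k + 1) * a k * g' k) n = g n * descProd a n * g' 0 := by
  induction n with
  | zero => simp [descProd, h']
  | succ n ih =>
    rw [descProd, ih, descProd]
    calc g (n + 1) * a n * g' n * (g n * descProd a n * g' 0)
        = g (n + 1) * a n * (g' n * g n) * descProd a n * g' 0 := by noncomm_ring
      _ = _ := by rw [h]; noncomm_ring

variable [CompleteSpace R]

/-- Behaviour of the limit of the Euler products under an infinitesimal gauge transformation. -/
theorem eulerLim_gauge {u B B' : ℝ → R} (hu : Continuous u) (hB : ∀ t, HasDerivAt B (B' t) t)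
    (hB' : Continuous B') (hBB : ∀ s t, B s * B t = 0) (hBuB : ∀ s r t, B s * u r * B t = 0) :
    eulerLim (fun t => u t - B' t - B t * u t + u t * B t) =
      (1 - B 1) * eulerLim u * (1 + B 0) := by
  have hBc : Continuous B := continuous_iff_continuousAt.2 fun t => (hB t).continuousAt
  have hv : Continuous fun t => u t - B' t - B t * u t + u t * B t := by fun_prop
  have hinv : ∀ t, (1 + B t) * (1 - B t) = 1 := fun t => by
    have : (1 + B t) * (1 - B t) = 1 - B t * B t := by noncomm_ring
    rw [this, hBB, sub_zero]
  have hinv' : ∀ t, (1 - B t) * (1 + B t) = 1 := fun t => by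
    have : (1 - B t) * (1 + B t) = 1 - B t * B t := by noncomm_ring
    rw [this, hBB, sub_zero]
  -- The factor on one mesh step, conjugated by the gauge elements at its two endpoints. Its
  -- products telescope, and it agrees with the factor of the transformed path up to `o(1/N)`.
  let a : ℕ → ℕ → R := fun N k =>
    (1 - B (((k + 1 : ℕ) : ℝ) / N)) * (1 + (N : ℝ)⁻¹ • u ((k : ℝ) / N)) * (1 + B ((k : ℝ) / N))
  have lim1 : Filter.Tendsto (fun N => descProd (a N) N) Filter.atTop
      (𝓝 ((1 - B 1) * eulerLim u * (1 + B 0))) := by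
    refine ((hu.tendsto_eulerLim.const_mul (1 - B 1)).mul_const (1 + B 0)).congr' ?_
    filter_upwards [Filter.eventually_gt_atTop 0] with N hN
    have hN' : (N : ℝ) ≠ 0 := by positivity
    have := descProd_gauge (a := fun k : ℕ => 1 + (N : ℝ)⁻¹ • u ((k : ℝ) / N))
      (g := fun k : ℕ => 1 - B ((k : ℝ) / N)) (g' := fun k : ℕ => 1 + B ((k : ℝ) / N))
      (fun _ => hinv _) (fun _ => hinv' _) N
    simp only [div_self hN', Nat.cast_zero, zero_div] at this
    exact this.symm
  refine tendsto_nhds_unique (hv.tendsto_descProd (a := a) fun ε hε => ?_) lim1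
  obtain ⟨C, hC, hb⟩ := hu.uniformFamily.bounded
  obtain ⟨δ₁, hδ₁, h₁⟩ := exists_uniform_taylor hB hB' (half_pos hε)
  obtain ⟨δ₂, hδ₂, h₂⟩ := hBc.uniformFamily.equicontinuous (ε / (2 * (C + 1))) (by positivity)
  have hsmall : ∀ᶠ N : ℕ in Filter.atTop, (N : ℝ)⁻¹ < min δ₁ δ₂ :=
    tendsto_inv_atTop_nhds_zero_nat.eventually_lt_const (by positivity)
  filter_upwards [hsmall, Filter.eventually_gt_atTop 0] with N hNδ hN k hk
  have hN' : (0 : ℝ) < N := by exact_mod_cast hN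
  have hh1 : (N : ℝ)⁻¹ ≤ δ₁ := hNδ.le.trans (min_le_left _ _)
  have hh2 : (N : ℝ)⁻¹ ≤ δ₂ := hNδ.le.trans (min_le_right _ _)
  have hstep : ((k + 1 : ℕ) : ℝ) / N = (k : ℝ) / N + (N : ℝ)⁻¹ := by
    push_cast; field_simp
  have ht := natCast_div_mem_Icc hk.le
  have ht' := natCast_div_mem_Icc (Nat.succ_le_of_lt hk)
  rw [Nat.succ_eq_add_one, hstep] at ht'
  simp only [a, hstep]
  set t := (k : ℝ) / N
  set h := (N : ℝ)⁻¹
  have hh0 : 0 ≤ h := by positivity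
  have k1 := h₁ t ht h hh0 hh1 ht'.2
  have k2 := h₂ () trivial (t + h) ht' t ht
    (by rw [add_sub_cancel_left, abs_of_nonneg hh0]; exact hh2)
  have k3 := hb () trivial t ht
  -- Terms containing two `B`'s vanish, even at distinct times. What remains is the Taylor remainder
  -- of `B` and `h` times an increment of `B`, both `o(h)`.
  have e : (1 - B (t + h)) * (1 + h • u t) * (1 + B t) -
      (1 + h • (u t - B' t - B t * u t + u t * B t)) =
      -(B (t + h) - B t - h • B' t) - h • ((B (t + h) - B t) * u t) := by
    have e1 : (1 - B (t + h)) * (1 + h • u t) * (1 + B t) =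
        1 + B t - B (t + h) - B (t + h) * B t + h • u t + h • (u t * B t) -
          h • (B (t + h) * u t) - h • (B (t + h) * u t * B t) := by
      simp only [mul_add, sub_mul, mul_one, one_mul, add_mul, smul_mul_assoc, mul_smul_comm,
        smul_sub]
      abel
    rw [e1, hBB, hBuB]
    simp only [sub_mul, smul_sub, smul_add, smul_zero]
    abel
  rw [e]
  calc _ ≤ ε / 2 * h + h * (ε / (2 * (C + 1)) * C) := by
        refine (norm_sub_le _ _).trans (add_le_add (by rwa [norm_neg]) ?_)
        rw [norm_smul, Real.norm_of_nonneg hh0]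
        gcongr
        exact (norm_mul_le _ _).trans (by gcongr)
    _ ≤ ε / 2 * h + h * (ε / (2 * (C + 1)) * (C + 1)) := by gcongr; linarith
    _ = ε * h := by field_simp; ring
    _ = ε / N := by rw [div_eq_mul_inv]

/-- The trace of the limit of the Euler products of a periodic path does not depend on the starting
point. -/
theorem trace_eulerLim_shift {V σ : Type*} [TopologicalSpace V] [T2Space V] [SetLike σ R]
    [SubmonoidClass σ R] {s : σ} {T : R → V} (hTc : Continuous T)
    (hT : ∀ x ∈ s, ∀ y ∈ s, T (x * y) = T (y * x)) {u : ℝ → R} (hu : Continuous u)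
    (hper : Function.Periodic u 1) (hs : ∀ (c : ℝ) (t : ℝ), 1 + c • u t ∈ s) {τ : ℝ} (hτ : 0 ≤ τ) :
    T (eulerLim fun t => u (t + τ)) = T (eulerLim u) := by
  -- Rounding `τ` down to the mesh makes the shifted product a cyclic shift of the original
  -- `N`-periodic sequence, at the cost of moving the sample points by at most `1 / N`.
  let a : ℕ → ℕ → R := fun N k => 1 + (N : ℝ)⁻¹ • u (((k + ⌊N * τ⌋₊ : ℕ) : ℝ) / N)
  have lim1 : Filter.Tendsto (fun N => descProd (a N) N) Filter.atTop
      (𝓝 (eulerLim fun t => u (t + τ))) := by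
    refine Continuous.tendsto_descProd (by fun_prop) fun ε hε => ?_
    have huc := (isCompact_Icc (a := (0 : ℝ)) (b := 1 + τ)).uniformContinuousOn_of_continuous
      hu.continuousOn
    rw [Metric.uniformContinuousOn_iff_le] at huc
    obtain ⟨δ, hδ, hd⟩ := huc ε hε
    filter_upwards [tendsto_inv_atTop_nhds_zero_nat.eventually_lt_const hδ,
      Filter.eventually_gt_atTop 0] with N hNδ hN k hk
    have hN' : (0 : ℝ) < N := by exact_mod_cast hN
    have hfl : (⌊N * τ⌋₊ : ℝ) ≤ N * τ := Nat.floor_le (by positivity)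
    have hfl' := (Nat.lt_floor_add_one (N * τ)).le
    have hk1 := natCast_div_mem_Icc hk.le
    have hq : ((k + ⌊N * τ⌋₊ : ℕ) : ℝ) / N = (k : ℝ) / N + ⌊N * τ⌋₊ / N := by
      push_cast; ring
    have hq1 : (⌊N * τ⌋₊ : ℝ) / N ≤ τ := by rw [div_le_iff₀ hN']; linarith
    have hq2 : τ - (⌊N * τ⌋₊ : ℝ) / N ≤ (N : ℝ)⁻¹ := by
      rw [sub_le_iff_le_add, ← one_div, ← add_div, le_div_iff₀ hN']; linarith
    have hq0 : 0 ≤ (⌊N * τ⌋₊ : ℝ) / N := by positivity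
    simp only [a, hq]
    rw [add_sub_add_left_eq_sub, ← smul_sub, norm_smul, norm_inv, Real.norm_natCast,
      inv_mul_eq_div]
    gcongr
    rw [← dist_eq_norm]
    refine hd _ ⟨by linarith [hk1.1], by linarith [hk1.2]⟩ _
      ⟨by linarith [hk1.1], by linarith [hk1.2]⟩ ?_
    rw [Real.dist_eq, abs_sub_comm, abs_of_nonneg] <;> linarith
  have lim2 : Filter.Tendsto (fun N => T (descProd (a N) N)) Filter.atTop (𝓝 (T (eulerLim u))) := by
    refine ((hTc.tendsto _).comp hu.tendsto_eulerLim).congr' ?_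
    filter_upwards [Filter.eventually_gt_atTop 0] with N hN
    have hN' : (N : ℝ) ≠ 0 := by positivity
    exact (trace_descProd_shift (a := fun k : ℕ => 1 + (N : ℝ)⁻¹ • u ((k : ℝ) / N)) hT
      (fun _ => hs _ _) (fun k => by
        have : ((k + N : ℕ) : ℝ) / N = (k : ℝ) / N + 1 := by push_cast; field_simp
        simp only [this, hper _]) _).symm
  exact tendsto_nhds_unique ((hTc.tendsto _).comp lim1) lim2

end Gauge

/-! ## Smooth dependence on parameters -/

section Smooth

open TrivSqZeroExt

variable {R : Type*} [NormedRing R]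

/-- The dual number `a + ε b`. -/
def dualMk (a b : R) : TrivSqZeroExt R R := inl a + inr b

@[simp] theorem fst_dualMk (a b : R) : (dualMk a b).fst = a := by
  rw [dualMk, fst_add, fst_inl, fst_inr, add_zero]

@[simp] theorem snd_dualMk (a b : R) : (dualMk a b).snd = b := by
  rw [dualMk, snd_add, snd_inl, snd_inr, zero_add]

variable [NormedAlgebra ℝ R]

/-- `dualMk` as a continuous linear map. -/
def dualMkL : R × R →L[ℝ] TrivSqZeroExt R R where
  toFun p := dualMk p.1 p.2
  map_add' p q := TrivSqZeroExt.ext (by simp) (by simp)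
  map_smul' c p := TrivSqZeroExt.ext (by simp) (by simp)
  cont := (TrivSqZeroExt.continuous_inl.comp _root_.continuous_fst).add
    (TrivSqZeroExt.continuous_inr.comp _root_.continuous_snd)

/-- The `ε`-component of a dual number as a continuous linear map. -/
def dualSndL : TrivSqZeroExt R R →L[ℝ] R where
  toFun := TrivSqZeroExt.snd
  map_add' _ _ := rfl
  map_smul' _ _ := rfl
  cont := TrivSqZeroExt.continuous_snd

/-- The path `u + ε ∂u/∂s` over the dual numbers. -/
def dualPath (u : ℝ × ℝ → R) (z : ℝ × ℝ) : TrivSqZeroExt R R :=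
  dualMk (u z) (fderiv ℝ u z (1, 0))

theorem contDiff_dualPath {u : ℝ × ℝ → R} (hu : ContDiff ℝ ∞ u) : ContDiff ℝ ∞ (dualPath u) := by
  have h : ContDiff ℝ ∞ fun z => fderiv ℝ u z (1, 0) :=
    (hu.fderiv_right (m := ∞) (by simp)).clm_apply contDiff_const
  exact (dualMkL (R := R)).contDiff.comp (hu.prodMk h)

/-- The `ε`-component of a product of dual numbers obeys the Leibniz rule. -/
theorem hasDerivAt_descProd {a : ℝ → ℕ → R} {a' : ℕ → R} {s : ℝ}
    (h : ∀ k, HasDerivAt (fun s => a s k) (a' k) s) (n : ℕ) :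
    HasDerivAt (fun s => descProd (a s) n)
      (descProd (fun k => dualMk (a s k) (a' k)) n).snd s := by
  have hfst : ∀ n, (descProd (fun k => dualMk (a s k) (a' k)) n).fst = descProd (a s) n :=
    fun n => by
    induction n with
    | zero => rfl
    | succ n ih => simp [descProd, ih]
  induction n with
  | zero => simpa [descProd] using hasDerivAt_const s (1 : R)
  | succ n ih =>
    have e : (descProd (fun k => dualMk (a s k) (a' k)) (n + 1)).snd =
        a' n * descProd (a s) n + a s n * (descProd (fun k => dualMk (a s k) (a' k)) n).snd := by
      simp [descProd, hfst, add_comm]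
    rw [e]
    exact (h n).mul ih

theorem hasDerivAt_eulerProd {u : ℝ × ℝ → R} (hu : ContDiff ℝ ∞ u) (s : ℝ) (N : ℕ) :
    HasDerivAt (fun s => eulerProd (fun t => u (s, t)) N)
      (eulerProd (fun t => dualPath u (s, t)) N).snd s := by
  have h : ∀ t, HasDerivAt (fun s => u (s, t)) (fderiv ℝ u (s, t) (1, 0)) s := fun t =>
    ((hu.differentiable (by simp)) (s, t)).hasFDerivAt.comp_hasDerivAt s
      ((hasDerivAt_id s).prodMk (hasDerivAt_const s t))
  have e : eulerProd (fun t => dualPath u (s, t)) N =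
      descProd (fun k : ℕ => dualMk (1 + (N : ℝ)⁻¹ • u (s, (k : ℝ) / N))
        ((N : ℝ)⁻¹ • fderiv ℝ u (s, (k : ℝ) / N) (1, 0))) N :=
    descProd_congr fun k _ => TrivSqZeroExt.ext (by simp [dualPath]) (by simp [dualPath])
  rw [e]
  exact hasDerivAt_descProd (a := fun s (k : ℕ) => 1 + (N : ℝ)⁻¹ • u (s, (k : ℝ) / N))
    (fun k => ((h ((k : ℝ) / N)).const_smul (N : ℝ)⁻¹).const_add (1 : R)) N

theorem tendstoLocallyUniformly_eulerProd [CompleteSpace R] {u : ℝ × ℝ → R} (hu : Continuous u) :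
    TendstoLocallyUniformly (fun N s => eulerProd (fun t => u (s, t)) N)
      (fun s => eulerLim fun t => u (s, t)) Filter.atTop := by
  rw [tendstoLocallyUniformly_iff_forall_isCompact]
  exact fun K hK => (UniformFamily.of_continuous hK
    (u := fun s t => u (s, t)) hu).tendstoUniformlyOn

/-- The convergence theorem over the dual numbers yields locally uniform convergence of the
derivatives, so the limit may be differentiated term by term. -/
theorem hasDerivAt_eulerLim [CompleteSpace R] {u : ℝ × ℝ → R} (hu : ContDiff ℝ ∞ u) (s : ℝ) :
    HasDerivAt (fun s => eulerLim fun t => u (s, t))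
      (eulerLim fun t => dualPath u (s, t)).snd s := by
  have h1 := tendstoLocallyUniformly_eulerProd (contDiff_dualPath hu).continuous
  have h2 : TendstoLocallyUniformlyOn
      (fun N s => (eulerProd (fun t => dualPath u (s, t)) N).snd)
      (fun s => (eulerLim fun t => dualPath u (s, t)).snd) Filter.atTop Set.univ :=
    tendstoLocallyUniformlyOn_univ.2
      ((dualSndL (R := R)).uniformContinuous.comp_tendstoLocallyUniformly h1)
  exact hasDerivAt_of_tendstoLocallyUniformlyOn isOpen_univ h2
    (Filter.Eventually.of_forall fun N s _ => hasDerivAt_eulerProd hu s N)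
    (fun s _ => Continuous.tendsto_eulerLim (by have := hu.continuous; fun_prop)) (Set.mem_univ s)

theorem contDiff_nat_eulerLim {R : Type u} [NormedRing R] [NormedAlgebra ℝ R] [CompleteSpace R]
    (n : ℕ) {u : ℝ × ℝ → R} (hu : ContDiff ℝ ∞ u) :
    ContDiff ℝ n fun s => eulerLim fun t => u (s, t) := by
  -- The algebra must vary: the derivative is a component of a limit over the dual numbers of `R`,
  -- to which the induction hypothesis is applied.
  induction n generalizing R with
  | zero =>
    exact contDiff_zero.2 (continuous_iff_continuousAt.2 fun s =>
      (hasDerivAt_eulerLim hu s).continuousAt)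
  | succ n ih =>
    rw [Nat.cast_add, Nat.cast_one, contDiff_succ_iff_deriv]
    refine ⟨fun s => (hasDerivAt_eulerLim hu s).differentiableAt, by simp, ?_⟩
    rw [show deriv (fun s => eulerLim fun t => u (s, t)) =
      fun s => dualSndL (eulerLim fun t => dualPath u (s, t)) from
      funext fun s => (hasDerivAt_eulerLim hu s).deriv]
    exact (dualSndL (R := R)).contDiff.comp (ih (contDiff_dualPath hu))

/-- The limit of the Euler products depends smoothly on parameters. -/
theorem contDiff_eulerLim [CompleteSpace R] {u : ℝ × ℝ → R} (hu : ContDiff ℝ ∞ u) :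
    ContDiff ℝ ∞ fun s => eulerLim fun t => u (s, t) :=
  contDiff_infty.2 fun n => contDiff_nat_eulerLim n hu

end Smooth

/-! ## Limits in finite-dimensional algebras -/

section FiniteDimensionalAlgebra

/-! ### A submultiplicative norm from the regular representation. -/

section Norm

variable (R : Type*) [Ring R] [Algebra ℝ R] [FiniteDimensional ℝ R]

/-- The regular representation of a finite-dimensional algebra, in coordinates. -/
def regularRep :
    R →ₐ[ℝ] (Fin (Module.finrank ℝ R) → ℝ) →L[ℝ] (Fin (Module.finrank ℝ R) → ℝ) :=
  ((Module.End.toContinuousLinearMap (𝕜 := ℝ) (Fin (Module.finrank ℝ R) → ℝ)).toAlgHom.comp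
    (LinearEquiv.conjAlgEquiv ℝ (Module.finBasis ℝ R).equivFun).toAlgHom).comp (Algebra.lmul ℝ R)

theorem regularRep_injective : Function.Injective (regularRep R) :=
  fun _ _ h => Algebra.lmul_injective (R := ℝ)
    ((LinearEquiv.conjAlgEquiv ℝ (Module.finBasis ℝ R).equivFun).injective
      ((Module.End.toContinuousLinearMap (𝕜 := ℝ) _).injective h))

/-- A submultiplicative norm on a finite-dimensional algebra. -/
abbrev finiteNormedRing : NormedRing R :=
  NormedRing.induced R _ (regularRep R) (regularRep_injective R)

/-- A submultiplicative norm on a finite-dimensional algebra makes it a normed algebra. -/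
abbrev finiteNormedAlgebra : letI := finiteNormedRing R; NormedAlgebra ℝ R :=
  letI := finiteNormedRing R
  NormedAlgebra.induced ℝ R _ (regularRep R)

end Norm

theorem FinTendsto.unique {V : Type*} [AddCommGroup V] [Module ℝ V] {u : ℕ → V} {v v' : V}
    (h : FinTendsto u v) (h' : FinTendsto u v') : v = v' := by
  rw [← sub_eq_zero, ← Module.forall_dual_apply_eq_zero_iff ℝ]
  intro l
  rw [map_sub, sub_eq_zero]
  exact tendsto_nhds_unique (h l) (h' l)

theorem FinTendsto.map {V V' : Type*} [AddCommGroup V] [Module ℝ V] [AddCommGroup V'] [Module ℝ V']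
    {u : ℕ → V} {v : V} (h : FinTendsto u v) (f : V →ₗ[ℝ] V') :
    FinTendsto (fun N => f (u N)) (f v) :=
  fun l => h (l ∘ₗ f)

/-- Subspaces are closed: in the quotient by `p` the sequence is constantly zero. -/
theorem FinTendsto.mem {V : Type*} [AddCommGroup V] [Module ℝ V] {u : ℕ → V} {v : V}
    (h : FinTendsto u v) {p : Submodule ℝ V} (hu : ∀ N, u N ∈ p) : v ∈ p := by
  rw [← Submodule.Quotient.mk_eq_zero]
  have h0 := h.map p.mkQ
  have : (fun N => p.mkQ (u N)) = fun _ => 0 := funext fun N => by simp [hu N]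
  rw [this] at h0
  exact h0.unique fun l => tendsto_const_nhds

/-- The actions of `ℂ` and of the real algebra structure agree on real scalars. -/
class OfRealSMulCompatible (R : Type*) [Ring R] [Algebra ℝ R] [Module ℂ R] : Prop where
  ofReal_smul : ∀ (c : ℝ) (x : R), (c : ℂ) • x = algebraMap ℝ R c * x

theorem pathExp_eq {R : Type*} [Ring R] [Algebra ℝ R] [Module ℂ R]
    [OfRealSMulCompatible R] {w : ℝ → R} {W : R}
    (h : @FinTendsto R _ Algebra.toModule (orderedProduct w) W) : pathExp w = W := by
  -- `R` carries two real module structures, one from the algebra and one restricted from `ℂ`;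
  -- `pathExp` tests convergence with the latter. They agree by compatibility of the scalars.
  have e : (Algebra.toModule : Module ℝ R) = Module.complexToReal R :=
    Module.ext' _ _ fun c x => (Algebra.smul_def c x).trans
      (OfRealSMulCompatible.ofReal_smul c x).symm
  rw [e] at h
  have hex : ∃ W : R, FinTendsto (orderedProduct w) W := ⟨W, h⟩
  rw [pathExp, dif_pos hex]
  exact hex.choose_spec.unique h

theorem orderedProduct_eq_eulerProd {R : Type*} [Ring R] [Algebra ℝ R] [Module ℂ R]
    [OfRealSMulCompatible R] (w : ℝ → R) (N : ℕ) :
    orderedProduct w N = eulerProd (fun t => Complex.I • w t) N := by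
  have h : ∀ (a : ℕ → R) (n : ℕ), ((List.range n).map a).reverse.prod = descProd a n := by
    intro a n
    induction n with
    | zero => rfl
    | succ n ih => simp [List.range_succ, descProd, ← ih]
  rw [orderedProduct, h, eulerProd]
  congr 1
  funext k
  rw [Algebra.smul_def, ← OfRealSMulCompatible.ofReal_smul, smul_smul, div_eq_inv_mul,
    Complex.ofReal_inv, Complex.ofReal_natCast]

variable {R : Type*} [NormedRing R] [NormedAlgebra ℝ R] [FiniteDimensional ℝ R]

theorem finTendsto_of_tendsto {u : ℕ → R} {v : R}
    (h : Filter.Tendsto u Filter.atTop (𝓝 v)) : FinTendsto u v :=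
  fun l => (l.continuous_of_finiteDimensional.tendsto v).comp h

end FiniteDimensionalAlgebra

/-! ## The algebra `End(H) ⊗ A` -/

section EndTensor

variable {H : Type*} [AddCommGroup H] [Module ℂ H] {A : ParamAlgebra}

variable (H A) in
/-- The elements of degree `n` of `End(H) ⊗ A`. -/
def degPart (n : ℤ) : Submodule ℝ (Module.End ℂ H ⊗[ℝ] A) :=
  LinearMap.range (LinearMap.lTensor (Module.End ℂ H) (A.gr n).subtype)

/-- Reduces statements about homogeneous elements of a tensor product to pure tensors with
homogeneous second factor. -/
theorem range_lTensor_induction {E F : Type*} [AddCommGroup E] [Module ℝ E] [AddCommGroup F]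
    [Module ℝ F] {p : Submodule ℝ F} (P : E ⊗[ℝ] F → Prop) {x : E ⊗[ℝ] F}
    (hx : x ∈ LinearMap.range (LinearMap.lTensor E p.subtype)) (zero : P 0)
    (tmul : ∀ (e : E), ∀ f ∈ p, P (e ⊗ₜ f)) (add : ∀ x y, P x → P y → P (x + y)) : P x := by
  obtain ⟨y, rfl⟩ := hx
  induction y with
  | zero => simpa
  | tmul e f => simpa using tmul e f f.2
  | add x y hx hy => rw [map_add]; exact add _ _ hx hy

theorem tmul_mem_range_lTensor {E F : Type*} [AddCommGroup E] [Module ℝ E] [AddCommGroup F]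
    [Module ℝ F] {p : Submodule ℝ F} (e : E) {f : F} (hf : f ∈ p) :
    e ⊗ₜ[ℝ] f ∈ LinearMap.range (LinearMap.lTensor E p.subtype) :=
  ⟨e ⊗ₜ ⟨f, hf⟩, by simp⟩

theorem mul_mem_degPart {m n : ℤ} {x y : Module.End ℂ H ⊗[ℝ] A} (hx : x ∈ degPart H A m)
    (hy : y ∈ degPart H A n) : x * y ∈ degPart H A (m + n) := by
  refine range_lTensor_induction (fun x => x * y ∈ degPart H A (m + n)) hx (by simp)
    (fun e a ha => ?_) fun x x' h h' => ?_
  · refine range_lTensor_induction (fun y => (e ⊗ₜ a) * y ∈ degPart H A (m + n)) hy (by simp)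
      (fun e' a' ha' => ?_) fun x x' h h' => ?_
    · rw [Algebra.TensorProduct.tmul_mul_tmul]
      exact tmul_mem_range_lTensor _ (SetLike.mul_mem_graded ha ha')
    · rw [mul_add]; exact add_mem h h'
  · rw [add_mul]; exact add_mem h h'

theorem I_smul_mem_degPart {n : ℤ} {x : Module.End ℂ H ⊗[ℝ] A} (hx : x ∈ degPart H A n) :
    Complex.I • x ∈ degPart H A n := by
  refine range_lTensor_induction (fun x => Complex.I • x ∈ degPart H A n) hx (by simp)
    (fun e a ha => ?_) fun x x' h h' => ?_
  · rw [TensorProduct.smul_tmul']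
    exact tmul_mem_range_lTensor _ ha
  · rw [smul_add]; exact add_mem h h'

variable (H A) in
/-- The subalgebra of elements of degree `0` of `End(H) ⊗ A`. -/
def degZero : Subalgebra ℝ (Module.End ℂ H ⊗[ℝ] A) :=
  (degPart H A 0).toSubalgebra (tmul_mem_range_lTensor _ SetLike.GradedOne.one_mem)
    fun _ _ hx hy => by simpa using mul_mem_degPart hx hy

/-- `End(H)` sits in degree 0 and `1` commutes with it, so the only sign is that of `A`. -/
theorem tmul_mul_comm_of_mem_degPart {m n : ℤ} {a : A} (ha : a ∈ A.gr m)
    {x : Module.End ℂ H ⊗[ℝ] A} (hx : x ∈ degPart H A n) :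
    ((1 : Module.End ℂ H) ⊗ₜ[ℝ] a) * x =
      ((m * n).negOnePow : ℤ) • (x * ((1 : Module.End ℂ H) ⊗ₜ[ℝ] a)) := by
  refine range_lTensor_induction (fun x => ((1 : Module.End ℂ H) ⊗ₜ[ℝ] a) * x =
    ((m * n).negOnePow : ℤ) • (x * ((1 : Module.End ℂ H) ⊗ₜ[ℝ] a))) hx (by simp)
    (fun e b hb => ?_) fun x x' h h' => ?_
  · rw [Algebra.TensorProduct.tmul_mul_tmul, Algebra.TensorProduct.tmul_mul_tmul, one_mul, mul_one,
      A.comm m n a b ha hb, TensorProduct.tmul_smul]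
  · rw [mul_add, h, h', add_mul, smul_add]

/-- For odd `η`, graded commutativity reads `η² = -η²`, and 2 is invertible. -/
theorem ParamAlgebra.mul_self_eq_zero {η : A} (hη : η ∈ A.gr (-1)) : η * η = 0 := by
  have h := A.comm _ _ η η hη hη
  simp only [mul_neg, neg_mul, one_mul, neg_neg, Int.negOnePow_one, Units.val_neg, Units.val_one,
    neg_smul, one_smul] at h
  have h2 : (2 : ℝ) • (η * η) = 0 := by rw [two_smul]; nth_rewrite 1 [h]; exact neg_add_cancel _
  exact (smul_eq_zero.1 h2).resolve_left two_ne_zero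

theorem ParamAlgebra.parity_apply (A : ParamAlgebra) {n : ℤ} {a : A} (ha : a ∈ A.gr n) :
    A.parity a = (n.negOnePow : ℤ) • a := by
  lift a to A.gr n using ha
  simp [ParamAlgebra.parity, DirectSum.lof_eq_of, ← Int.cast_smul_eq_zsmul ℝ]

theorem tmul_mul_comm_of_odd {η : A} (hη : η ∈ A.gr (-1))
    {x : Module.End ℂ H ⊗[ℝ] A} (hx : x ∈ degPart H A 1) :
    x * ((1 : Module.End ℂ H) ⊗ₜ[ℝ] η) + ((1 : Module.End ℂ H) ⊗ₜ[ℝ] η) * x = 0 := by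
  rw [tmul_mul_comm_of_mem_degPart hη hx]
  simp

theorem tmul_mul_comm_of_even {η : A} (hη : η ∈ A.gr (-1))
    {x : Module.End ℂ H ⊗[ℝ] A} (hx : x ∈ degPart H A 0) :
    x * ((1 : Module.End ℂ H) ⊗ₜ[ℝ] η) = ((1 : Module.End ℂ H) ⊗ₜ[ℝ] η) * x := by
  rw [tmul_mul_comm_of_mem_degPart hη hx]
  simp

/-- Moving `η` past `x` produces `η² = 0`. This kills all terms quadratic in the gauge parameter. -/
theorem tmul_mul_mul_tmul_eq_zero {η : A} (hη : η ∈ A.gr (-1))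
    {x : Module.End ℂ H ⊗[ℝ] A} (hx : x ∈ degPart H A 1) :
    ((1 : Module.End ℂ H) ⊗ₜ[ℝ] η) * x * ((1 : Module.End ℂ H) ⊗ₜ[ℝ] η) = 0 := by
  have h := congrArg (((1 : Module.End ℂ H) ⊗ₜ[ℝ] η) * ·) (tmul_mul_comm_of_odd hη hx)
  simpa only [mul_add, mul_zero, ← mul_assoc, Algebra.TensorProduct.tmul_mul_tmul,
    ParamAlgebra.mul_self_eq_zero hη, TensorProduct.tmul_zero, zero_mul, add_zero] using h

variable (H A) in
/-- The trace over `H` with values in `ℂ ⊗ A`. -/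
def partialTrace : Module.End ℂ H ⊗[ℝ] A →ₗ[ℝ] ℂ ⊗[ℝ] A :=
  LinearMap.rTensor A ((LinearMap.trace ℂ H).restrictScalars ℝ)

/-- In degree 0 the coefficients in `A` commute without sign, so cyclicity reduces to that of the
trace on `End(H)`. -/
theorem partialTrace_mul_comm {x y : Module.End ℂ H ⊗[ℝ] A} (hx : x ∈ degZero H A)
    (hy : y ∈ degZero H A) : partialTrace H A (x * y) = partialTrace H A (y * x) := by
  refine range_lTensor_induction (fun x => partialTrace H A (x * y) = partialTrace H A (y * x)) hx
    (by simp) (fun e a ha => ?_) fun x x' h h' => ?_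
  · refine range_lTensor_induction (fun y => partialTrace H A ((e ⊗ₜ a) * y) =
      partialTrace H A (y * (e ⊗ₜ a))) hy (by simp)
      (fun e' a' ha' => ?_) fun x x' h h' => ?_
    · have := A.comm 0 0 a a' ha ha'
      simp only [mul_zero, Int.negOnePow_zero, Units.val_one, one_smul] at this
      simp [partialTrace, this, LinearMap.trace_mul_comm ℂ e e']
    · rw [mul_add, map_add, h, h', add_mul, map_add]
  · rw [mul_add, map_add, add_mul, map_add, h, h']

theorem partialTrace_mem {x : Module.End ℂ H ⊗[ℝ] A} (hx : x ∈ degZero H A) :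
    partialTrace H A x ∈ LinearMap.range (LinearMap.lTensor ℂ (A.gr 0).subtype) := by
  refine range_lTensor_induction (fun x => partialTrace H A x ∈
    LinearMap.range (LinearMap.lTensor ℂ (A.gr 0).subtype)) hx (by simp)
    (fun e a ha => ?_) fun x x' h h' => ?_
  · exact tmul_mem_range_lTensor _ ha
  · rw [map_add]; exact add_mem h h'

theorem partialTrace_lTensor {B : ParamAlgebra} (φ : A →ₗ[ℝ] B) (x : Module.End ℂ H ⊗[ℝ] A) :
    partialTrace H B (LinearMap.lTensor (Module.End ℂ H) φ x) =
      LinearMap.lTensor ℂ φ (partialTrace H A x) := by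
  rw [partialTrace, partialTrace, ← LinearMap.comp_apply, ← LinearMap.comp_apply,
    LinearMap.rTensor_comp_lTensor, LinearMap.lTensor_comp_rTensor]

theorem lTensor_orderedProduct {B : ParamAlgebra} (φ : A →ₐ[ℝ] B)
    (w : ℝ → Module.End ℂ H ⊗[ℝ] A) (N : ℕ) :
    LinearMap.lTensor (Module.End ℂ H) φ.toLinearMap (orderedProduct w N) =
      orderedProduct (fun t => LinearMap.lTensor (Module.End ℂ H) φ.toLinearMap (w t)) N := by
  let Φ := Algebra.TensorProduct.map (AlgHom.id ℂ (Module.End ℂ H)) φ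
  have hΦ : ∀ x, LinearMap.lTensor (Module.End ℂ H) φ.toLinearMap x = Φ x := fun x => rfl
  simp only [hΦ, orderedProduct]
  rw [map_list_prod, List.map_reverse, List.map_map]
  congr 3
  funext k
  simp

instance ofRealSMulCompatible_end : OfRealSMulCompatible (Module.End ℂ H ⊗[ℝ] A) where
  ofReal_smul c x := by
    rw [← Algebra.smul_def]
    rfl

variable [FiniteDimensional ℂ H]

instance finiteDimensional_end : FiniteDimensional ℝ (Module.End ℂ H) :=
  Module.Finite.trans ℂ _

variable (H A) in
/-- A norm on `End(H) ⊗ A`. -/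
abbrev endNormedRing : NormedRing (Module.End ℂ H ⊗[ℝ] A) := finiteNormedRing _

attribute [local instance] endNormedRing

variable (H A) in
/-- A norm on `End(H) ⊗ A`. -/
abbrev endNormedAlgebra : NormedAlgebra ℝ (Module.End ℂ H ⊗[ℝ] A) := finiteNormedAlgebra _

attribute [local instance] endNormedAlgebra

theorem finTendsto_orderedProduct {w : ℝ → Module.End ℂ H ⊗[ℝ] A}
    (hw : Continuous fun t => Complex.I • w t) :
    FinTendsto (orderedProduct w) (eulerLim fun t => Complex.I • w t) := by
  have : CompleteSpace (Module.End ℂ H ⊗[ℝ] A) := FiniteDimensional.complete ℝ _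
  rw [show orderedProduct w = _ from funext (orderedProduct_eq_eulerProd w)]
  exact finTendsto_of_tendsto hw.tendsto_eulerLim

theorem pathExp_eq_eulerLim {w : ℝ → Module.End ℂ H ⊗[ℝ] A}
    (hw : Continuous fun t => Complex.I • w t) :
    pathExp w = eulerLim fun t => Complex.I • w t :=
  pathExp_eq (finTendsto_orderedProduct hw)

theorem eulerLim_mem_degZero {w : ℝ → Module.End ℂ H ⊗[ℝ] A}
    (hw : Continuous fun t => Complex.I • w t) (h0 : ∀ t, w t ∈ degPart H A 0) :
    (eulerLim fun t => Complex.I • w t) ∈ degZero H A := by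
  refine (finTendsto_orderedProduct hw).mem (p := degPart H A 0) fun N => ?_
  rw [orderedProduct_eq_eulerProd]
  exact descProd_mem (s := degZero H A) (fun k => add_mem (one_mem _)
    (Subalgebra.smul_mem _ (I_smul_mem_degPart (h0 _)) _)) N

end EndTensor

/-! ## Pull-back of forms to a path -/

section PullBack

/-- Expanded in a basis, the value is a polynomial in the coordinates of `v`, with the smooth
components of `f` as coefficients. -/
theorem ContDiffAt.alternatingMap_apply {d k : ℕ} {F E' : Type*} [NormedAddCommGroup F]
    [NormedSpace ℝ F] [NormedAddCommGroup E'] [NormedSpace ℝ E']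
    {f : E' → EuclideanSpace ℝ (Fin d) [⋀^Fin k]→L[ℝ] F} {v : E' → EuclideanSpace ℝ (Fin d)}
    {z : E'} (hf : ContDiffAt ℝ ∞ f z) (hv : ContDiffAt ℝ ∞ v z) :
    ContDiffAt ℝ ∞ (fun z => f z fun _ => v z) z := by
  let e := (EuclideanSpace.basisFun (Fin d) ℝ)
  have h : ∀ z, (f z fun _ => v z) =
      ∑ r : Fin k → Fin d, (∏ i, v z (r i)) • f z fun i => e (r i) := fun z => by
    have hs : v z = ∑ j, v z j • e j := by
      simpa [e] using (e.sum_repr (v z)).symm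
    have h1 := (f z).toContinuousMultilinearMap.map_sum (fun (_ : Fin k) j => v z j • e j)
    rw [← hs] at h1
    refine h1.trans (Finset.sum_congr rfl fun r _ => ?_)
    exact (f z).toContinuousMultilinearMap.map_smul_univ (fun i => v z (r i)) fun i => e (r i)
  simp only [h]
  refine ContDiffAt.sum fun r _ => ContDiffAt.smul (contDiffAt_prod fun i _ => ?_) ?_
  · exact (EuclideanSpace.proj (𝕜 := ℝ) (r i)).contDiff.contDiffAt.comp z hv
  · exact (ContinuousAlternatingMap.apply ℝ (EuclideanSpace ℝ (Fin d)) F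
      fun i => e (r i)).contDiff.contDiffAt.comp z hf

variable {d : ℕ} {S : Type*} [TopologicalSpace S] [ChartedSpace (EuclideanSpace ℝ (Fin d)) S]
  {A : ParamAlgebra}

theorem form_apply_congr {k : ℕ} (α : ∀ x : S, TangentSpace (𝓡 d) x [⋀^Fin k]→L[ℝ] A) {x y : S}
    (h : x = y) (v : Fin k → EuclideanSpace ℝ (Fin d)) : α x v = α y v := by
  subst h; rfl

variable {c : ℝ → S}

theorem contDiffAt_extChartAt_comp (hc : ContMDiff 𝓘(ℝ, ℝ) (𝓡 d) ∞ c) (t₀ : ℝ) :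
    ContDiffAt ℝ ∞ (fun t => extChartAt (𝓡 d) (c t₀) (c t)) t₀ := by
  rw [← contMDiffAt_iff_contDiffAt]
  exact contMDiffAt_extChartAt.comp t₀ (hc t₀)

variable [IsManifold (𝓡 d) ∞ S]

/-- Near `t₀` the path stays in one chart, and the chain rule applies to the inverse chart composed
with the path in coordinates. One neighbourhood serves all forms, which allows the form to vary with
a parameter. -/
theorem eventually_apply_eq_chartForm (hc : ContMDiff 𝓘(ℝ, ℝ) (𝓡 d) ∞ c) (t₀ : ℝ) :
    ∀ᶠ t in 𝓝 t₀, ∀ (k : ℕ) (α : ∀ x : S, TangentSpace (𝓡 d) x [⋀^Fin k]→L[ℝ] A),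
      α (c t) (fun _ => mfderiv 𝓘(ℝ, ℝ) (𝓡 d) c t (1 : ℝ)) =
        chartForm α (c t₀) (extChartAt (𝓡 d) (c t₀) (c t))
          (fun _ => fderiv ℝ (fun t => extChartAt (𝓡 d) (c t₀) (c t)) t 1) := by
  have hopen : IsOpen (c ⁻¹' (extChartAt (𝓡 d) (c t₀)).source) :=
    (isOpen_extChartAt_source (c t₀)).preimage hc.continuous
  filter_upwards [hopen.mem_nhds (mem_extChartAt_source (I := 𝓡 d) (c t₀))] with t ht k α
  have hinv : (extChartAt (𝓡 d) (c t₀)).symm (extChartAt (𝓡 d) (c t₀) (c t)) = c t :=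
    (extChartAt (𝓡 d) (c t₀)).left_inv ht
  have htarget := (extChartAt (𝓡 d) (c t₀)).map_source ht
  have hsymm : MDifferentiableAt 𝓘(ℝ, EuclideanSpace ℝ (Fin d)) (𝓡 d)
      (extChartAt (𝓡 d) (c t₀)).symm (extChartAt (𝓡 d) (c t₀) (c t)) :=
    ((contMDiffOn_extChartAt_symm (n := ∞) (c t₀)).contMDiffAt
      (extChartAt_target_mem_nhds' htarget)).mdifferentiableAt (by simp)
  have hφ : MDifferentiableAt 𝓘(ℝ, ℝ) 𝓘(ℝ, EuclideanSpace ℝ (Fin d))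
      (fun t => extChartAt (𝓡 d) (c t₀) (c t)) t :=
    ((contMDiffAt_extChartAt' (n := ∞) (by rwa [extChartAt_source] at ht)).comp t
      (hc t)).mdifferentiableAt (by simp)
  have heq : c =ᶠ[𝓝 t] (extChartAt (𝓡 d) (c t₀)).symm ∘ fun t => extChartAt (𝓡 d) (c t₀) (c t) := by
    filter_upwards [hopen.mem_nhds ht] with t' ht'
    exact ((extChartAt (𝓡 d) (c t₀)).left_inv ht').symm
  have hd : (mfderiv 𝓘(ℝ, ℝ) (𝓡 d) c t (1 : ℝ) : EuclideanSpace ℝ (Fin d)) =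
      mfderiv 𝓘(ℝ, EuclideanSpace ℝ (Fin d)) (𝓡 d) (extChartAt (𝓡 d) (c t₀)).symm
        (extChartAt (𝓡 d) (c t₀) (c t))
        (fderiv ℝ (fun t => extChartAt (𝓡 d) (c t₀) (c t)) t 1) := by
    rw [heq.mfderiv_eq, mfderiv_comp t hsymm hφ, mfderiv_eq_fderiv]
    rfl
  rw [chartForm]
  refine (form_apply_congr α hinv.symm _).trans ?_
  rw [hd]
  rfl

/-- The derivative along a path of a `0`-form. -/
theorem hasDerivAt_zeroForm (hc : ContMDiff 𝓘(ℝ, ℝ) (𝓡 d) ∞ c)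
    {α : ∀ x : S, TangentSpace (𝓡 d) x [⋀^Fin 0]→L[ℝ] A} (hα : IsSmoothForm α) (t : ℝ) :
    HasDerivAt (fun t => α (c t) (fun _ => mfderiv 𝓘(ℝ, ℝ) (𝓡 d) c t (1 : ℝ)))
      (extDerivForm α (c t) (fun _ => mfderiv 𝓘(ℝ, ℝ) (𝓡 d) c t (1 : ℝ))) t := by
  have h1 : (fun t => α (c t) (fun _ => mfderiv 𝓘(ℝ, ℝ) (𝓡 d) c t (1 : ℝ))) =ᶠ[𝓝 t]
      fun t' => chartForm α (c t) (extChartAt (𝓡 d) (c t) (c t')) 0 := by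
    filter_upwards [eventually_apply_eq_chartForm (A := A) hc t] with t' ht'
    rw [ht' 0 α]
    congr 1
    exact Subsingleton.elim _ _
  refine HasDerivAt.congr_of_eventuallyEq ?_ h1
  have hφ := ((contDiffAt_extChartAt_comp hc t).differentiableAt (by simp)).hasFDerivAt.hasDerivAt
  have hα' := hα.differentiableAt (c t)
  have hα0 : DifferentiableAt ℝ (fun y => chartForm α (c t) y 0) (extChartAt (𝓡 d) (c t) (c t)) :=
    DifferentiableAt.comp (g := ContinuousAlternatingMap.apply ℝ (EuclideanSpace ℝ (Fin d)) A 0) _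
      (ContinuousLinearMap.differentiableAt _) hα'
  have h2 := hα0.hasFDerivAt.comp_hasDerivAt t hφ
  have hmf : mfderiv (𝓡 d) 𝓘(ℝ, EuclideanSpace ℝ (Fin d)) (extChartAt (𝓡 d) (c t)) (c t)
      (mfderiv 𝓘(ℝ, ℝ) (𝓡 d) c t (1 : ℝ)) =
      fderiv ℝ (fun t' => extChartAt (𝓡 d) (c t) (c t')) t 1 := by
    rw [← mfderiv_eq_fderiv]
    exact (mfderiv_comp_apply t
      (contMDiffAt_extChartAt (n := ∞).mdifferentiableAt (by simp))
      ((hc t).mdifferentiableAt (by simp)) (1 : ℝ)).symm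
  have hv : extDerivForm α (c t) (fun _ => mfderiv 𝓘(ℝ, ℝ) (𝓡 d) c t (1 : ℝ)) =
      extDeriv (chartForm α (c t)) (extChartAt (𝓡 d) (c t) (c t))
        (fun _ => fderiv ℝ (fun t' => extChartAt (𝓡 d) (c t) (c t')) t 1) := by
    rw [← hmf]; rfl
  -- For a 0-form the sum defining `extDeriv` has a single term, evaluated on the empty family.
  have hz : ∀ v : Fin 1 → EuclideanSpace ℝ (Fin d), Fin.removeNth 0 v = 0 := fun v =>
    Subsingleton.elim _ _
  rw [hv, extDeriv_apply hα', Fin.sum_univ_one, Fin.val_zero, pow_zero, one_smul, hz]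
  exact h2

end PullBack

/-! ## Products of forms evaluated on one vector -/

section Products

variable {A : ParamAlgebra} {V : Type*} [AddCommGroup V] [Module ℝ V] [TopologicalSpace V]

/-- With at most one argument there is only one shuffle. -/
theorem wedge_apply_of_subsingleton {k l : ℕ} [Subsingleton (Fin k ⊕ Fin l)]
    (α : V [⋀^Fin k]→L[ℝ] A) (β : V [⋀^Fin l]→L[ℝ] A) (v : V) :
    wedge α β (fun _ => v) = α (fun _ => v) * β (fun _ => v) := by
  have : Subsingleton (Equiv.Perm.ModSumCongr (Fin k) (Fin l)) := by
    unfold Equiv.Perm.ModSumCongr; infer_instance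
  have h : (α.toAlternatingMap.domCoprod β.toAlternatingMap) (fun _ => v) =
      α (fun _ => v) ⊗ₜ β (fun _ => v) := by
    let σ₀ : Equiv.Perm.ModSumCongr (Fin k) (Fin l) := Quotient.mk'' 1
    have hs : (↑(α.toAlternatingMap.domCoprod β.toAlternatingMap) :
        MultilinearMap ℝ (fun _ : Fin k ⊕ Fin l => V) (A ⊗[ℝ] A)) =
        AlternatingMap.domCoprod.summand α.toAlternatingMap β.toAlternatingMap σ₀ := by
      rw [AlternatingMap.domCoprod_coe]
      exact Finset.sum_eq_single σ₀ (fun σ _ h => absurd (Subsingleton.elim _ _) h)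
        (fun h => absurd (Finset.mem_univ _) h)
    refine (congrArg (fun f => f fun _ => v) (hs.trans
      (AlternatingMap.domCoprod.summand_mk'' _ _ _))).trans ?_
    simp
  simp [wedge, Function.comp_def, h]

variable {d : ℕ} {S : Type*} [TopologicalSpace S] [ChartedSpace (EuclideanSpace ℝ (Fin d)) S]

theorem formMul_one (α β : Form (d := d) S A) (x : S) (v : TangentSpace (𝓡 d) x) :
    formMul α β 1 x (fun _ => v) =
      α 0 x (fun _ => v) * β 1 x (fun _ => v) +
        α 1 x (fun _ => v) * A.parity (β 0 x (fun _ => v)) := by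
  have : Subsingleton (Fin 0 ⊕ Fin 1) := ⟨by decide⟩
  have : Subsingleton (Fin 1 ⊕ Fin 0) := ⟨by decide⟩
  let g : ℕ × ℕ → A := fun p => wedge (α p.1 x)
      ((LinearMap.toContinuousLinearMap (A.parity ^ p.1)).compContinuousAlternatingMap (β p.2 x))
      (fun _ => v)
  have h : formMul α β 1 x (fun _ => v) =
      ∑ p ∈ (Finset.HasAntidiagonal.antidiagonal 1).attach, g p.1 := rfl
  rw [h, Finset.sum_attach _ g, Finset.Nat.antidiagonal_succ]
  have e₁ := wedge_apply_of_subsingleton (α 0 x)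
    ((LinearMap.toContinuousLinearMap (A.parity ^ 0)).compContinuousAlternatingMap (β 1 x)) v
  have e₂ := wedge_apply_of_subsingleton (α 1 x)
    ((LinearMap.toContinuousLinearMap (A.parity ^ 1)).compContinuousAlternatingMap (β 0 x)) v
  simp only [pow_zero, pow_one] at e₁ e₂
  simpa [g] using congrArg₂ (· + ·) e₁ e₂

end Products

/-! ## Fields along a path -/

section Paths

variable {d : ℕ} {S : Type*} [TopologicalSpace S] [ChartedSpace (EuclideanSpace ℝ (Fin d)) S]
  {M : GradedManifold.{u}} {A : ParamAlgebra}

/-- The value of the `k`-form component of `f(Y)` at time `t` on the velocity of the path `c`. -/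
def pathEval (c : ℝ → S) (Y : M.Fun →ₗ[ℝ] Form (d := d) S A) (k : ℕ) (t : ℝ) : M.Fun →ₗ[ℝ] A where
  toFun f := Y f k (c t) (fun _ => mfderiv 𝓘(ℝ, ℝ) (𝓡 d) c t (1 : ℝ))
  map_add' f g := by simp
  map_smul' r f := by simp

theorem pathEval_comp_add {c : ℝ → S} (hc : MDifferentiable 𝓘(ℝ, ℝ) (𝓡 d) c)
    (Y : M.Fun →ₗ[ℝ] Form (d := d) S A) (k : ℕ) (τ t : ℝ) :
    pathEval (fun t => c (t + τ)) Y k t = pathEval c Y k (t + τ) := by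
  have h : mfderiv 𝓘(ℝ, ℝ) (𝓡 d) (fun t => c (t + τ)) t (1 : ℝ) =
      mfderiv 𝓘(ℝ, ℝ) (𝓡 d) c (t + τ) (1 : ℝ) := by
    have hd : HasFDerivAt (fun t : ℝ => t + τ) (ContinuousLinearMap.id ℝ ℝ) t :=
      (hasFDerivAt_id t).add_const τ
    have := mfderiv_comp_apply t (I' := 𝓘(ℝ, ℝ)) (g := c)
      (f := fun t : ℝ => t + τ) (hc _) hd.differentiableAt.mdifferentiableAt (1 : ℝ)
    rw [mfderiv_eq_fderiv, hd.fderiv] at this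
    exact this
  ext f
  exact congrArg (fun v : EuclideanSpace ℝ (Fin d) => Y f k (c (t + τ)) fun _ => v) h

theorem isSmoothCurve_const (X : Superfield (d := d) S M A) : IsSmoothCurve fun _ => X :=
  fun f k x₀ => (X.smooth f k x₀).comp contDiff_snd.contDiffOn fun _ hz => hz.2

theorem contDiff_pathEval [IsManifold (𝓡 d) ∞ S] {c : ℝ → S}
    (hc : ContMDiff 𝓘(ℝ, ℝ) (𝓡 d) ∞ c) {X : ℝ → Superfield (d := d) S M A}
    (hX : IsSmoothCurve X) (k : ℕ) (f : M.Fun) :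
    ContDiff ℝ ∞ fun z : ℝ × ℝ => pathEval c (X z.1).toLin k z.2 f := by
  rw [contDiff_iff_contDiffAt]
  rintro ⟨s₀, t₀⟩
  have hφ : ContDiffAt ℝ ∞ (fun z : ℝ × ℝ => extChartAt (𝓡 d) (c t₀) (c z.2)) (s₀, t₀) :=
    ContDiffAt.comp (s₀, t₀) (g := fun t => extChartAt (𝓡 d) (c t₀) (c t))
      (contDiffAt_extChartAt_comp hc t₀) contDiffAt_snd
  have hφ' : ContDiffAt ℝ ∞ (fun z : ℝ × ℝ =>
      fderiv ℝ (fun t => extChartAt (𝓡 d) (c t₀) (c t)) z.2 1) (s₀, t₀) :=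
    ContDiffAt.comp (s₀, t₀) (g := fun t => fderiv ℝ (fun t => extChartAt (𝓡 d) (c t₀) (c t)) t 1)
      (((contDiffAt_extChartAt_comp hc t₀).fderiv_right (m := ∞) (by simp)).clm_apply
        contDiffAt_const) contDiffAt_snd
  have hF : ContDiffAt ℝ ∞ (fun z : ℝ × EuclideanSpace ℝ (Fin d) =>
      chartForm ((X z.1).toLin f k) (c t₀) z.2) (s₀, extChartAt (𝓡 d) (c t₀) (c t₀)) :=
    (hX f k (c t₀)).contDiffAt
      (prod_mem_nhds Filter.univ_mem (extChartAt_target_mem_nhds (c t₀)))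
  have hF' : ContDiffAt ℝ ∞ (fun z : ℝ × ℝ =>
      chartForm ((X z.1).toLin f k) (c t₀) (extChartAt (𝓡 d) (c t₀) (c z.2))) (s₀, t₀) :=
    ContDiffAt.comp (s₀, t₀) (f := fun z : ℝ × ℝ => (z.1, extChartAt (𝓡 d) (c t₀) (c z.2))) hF
      (contDiffAt_fst.prodMk hφ)
  refine (hF'.alternatingMap_apply hφ').congr_of_eventuallyEq ?_
  have hev := (continuous_snd.tendsto (s₀, t₀)).eventually
    (eventually_apply_eq_chartForm (A := A) hc t₀)
  filter_upwards [hev] with z hz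
  exact hz k ((X z.1).toLin f k)

variable {c : ℝ → S}

theorem pathEval_mem (X : Superfield (d := d) S M A) {n : ℤ} {f : M.Fun} (hf : f ∈ M.gr ⊤ n)
    (k : ℕ) (t : ℝ) : pathEval c X.toLin k t f ∈ A.gr (n - k) :=
  X.degree n f hf k _ _

/-- The 0-form component of `g(X)` is odd, so the Koszul sign for moving the 1-form past it is `-1`.
For `Θ²` this sign creates the commutator. -/
theorem pathEval_mul (X : Superfield (d := d) S M A) {f g : M.Fun} (hg : g ∈ M.gr ⊤ 1) (t : ℝ) :
    pathEval c X.toLin 1 t (f * g) + pathEval c X.toLin 1 t f * pathEval c X.toLin 0 t g =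
      pathEval c X.toLin 0 t f * pathEval c X.toLin 1 t g := by
  have h := X.map_mul f g 1 (c t) (fun _ => mfderiv 𝓘(ℝ, ℝ) (𝓡 d) c t (1 : ℝ))
  rw [formMul_one] at h
  have h0 := A.parity_apply (pathEval_mem (c := c) X hg 0 t)
  simp only [Nat.cast_zero, sub_zero, Int.negOnePow_one, Units.val_neg, Units.val_one, neg_smul,
    one_smul] at h0
  have h' : pathEval c X.toLin 1 t (f * g) =
      pathEval c X.toLin 0 t f * pathEval c X.toLin 1 t g +
        pathEval c X.toLin 1 t f * A.parity (pathEval c X.toLin 0 t g) := h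
  rw [h', h0, mul_neg, neg_add_cancel_right]

/-- The de Rham differential of superfields, `f ↦ d (f(X))`. -/
def deRhamField (X : Superfield (d := d) S M A) : M.Fun →ₗ[ℝ] Form (d := d) S A where
  toFun f := deRham (X.toLin f)
  map_add' f g := by rw [map_add, deRham_add (X.smooth f) (X.smooth g)]
  map_smul' r f := by rw [map_smul, deRham_smul]; rfl

theorem hasDerivAt_pathEval [IsManifold (𝓡 d) ∞ S] (hc : ContMDiff 𝓘(ℝ, ℝ) (𝓡 d) ∞ c)
    (X : Superfield (d := d) S M A) {f : M.Fun} (hf : f ∈ M.gr ⊤ 1) (t : ℝ) :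
    HasDerivAt (fun t => pathEval c X.toLin 0 t f) (-pathEval c (deRhamField X) 1 t f) t := by
  have h := hasDerivAt_zeroForm hc (X.smooth f 0) t
  set D := extDerivForm (X.toLin f 0) (c t) (fun _ => mfderiv 𝓘(ℝ, ℝ) (𝓡 d) c t (1 : ℝ))
  have hD : pathEval c (deRhamField X) 1 t f = A.parity D := rfl
  have h1 : HasDerivAt (fun t => A.parity (pathEval c X.toLin 0 t f)) (A.parity D) t :=
    (LinearMap.toContinuousLinearMap A.parity).hasFDerivAt.comp_hasDerivAt t h
  have h2 : (fun t => A.parity (pathEval c X.toLin 0 t f)) =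
      fun t => -pathEval c X.toLin 0 t f := by
    funext t
    rw [A.parity_apply (pathEval_mem (c := c) X hf 0 t)]
    simp
  rw [h2] at h1
  -- The curve is odd, so `A.parity` negates it; uniqueness of derivatives gives `A.parity D = -D`
  -- without determining the degree of `D` separately.
  rw [hD, h1.unique h.neg, neg_neg]
  exact h

theorem pathEval_variation (Q : CohomologicalVectorField M) (X : Superfield (d := d) S M A) (η : A)
    (t : ℝ) :
    pathEval c (X.toLin + constMul η ∘ₗ aksz Q X) 1 t = pathEval c X.toLin 1 t +
      LinearMap.mulLeft ℝ η ∘ₗ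
        (pathEval c (deRhamField X) 1 t + pathEval c X.toLin 1 t ∘ₗ Q.toLin) := rfl

end Paths

/-! ## The connection along a path -/

theorem ContDiff.linearMap_comp {E F F' : Type*} [NormedAddCommGroup E] [NormedSpace ℝ E]
    [NormedAddCommGroup F] [NormedSpace ℝ F] [FiniteDimensional ℝ F] [NormedAddCommGroup F']
    [NormedSpace ℝ F'] (l : F →ₗ[ℝ] F') {g : E → F} (hg : ContDiff ℝ ∞ g) :
    ContDiff ℝ ∞ fun x => l (g x) :=
  (LinearMap.toContinuousLinearMap l).contDiff.comp hg

theorem ContDiff.comp_prodMk_left {F : Type*} [NormedAddCommGroup F] [NormedSpace ℝ F]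
    {g : ℝ × ℝ → F} (hg : ContDiff ℝ ∞ g) (s : ℝ) : ContDiff ℝ ∞ fun t => g (s, t) :=
  hg.comp (contDiff_const.prodMk contDiff_id)

section Connection

variable {d : ℕ} {S : Type*} [TopologicalSpace S] [ChartedSpace (EuclideanSpace ℝ (Fin d)) S]
  {M : GradedManifold.{u}} {A : ParamAlgebra} {H : Type*} [AddCommGroup H] [Module ℂ H]

/-- The value of the `k`-form component of `Θ(Y)` at time `t` on the velocity of the path `c`. -/
def endEval (c : ℝ → S) (Θ : Module.End ℂ H ⊗[ℝ] M.Fun) (Y : M.Fun →ₗ[ℝ] Form (d := d) S A) (k : ℕ)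
    (t : ℝ) : Module.End ℂ H ⊗[ℝ] A :=
  LinearMap.lTensor (Module.End ℂ H) (pathEval c Y k t) Θ

theorem loopIntegrand_eq (Θ : Module.End ℂ H ⊗[ℝ] M.Fun) (γ : Circle → S) (p : Circle)
    (Y : M.Fun →ₗ[ℝ] Form (d := d) S A) :
    loopIntegrand Θ γ p A Y = endEval (loopPath γ p) Θ Y 1 := rfl

variable {c : ℝ → S} {Θ : Module.End ℂ H ⊗[ℝ] M.Fun}

theorem endEval_mem
    (hdeg : Θ ∈ LinearMap.range (LinearMap.lTensor (Module.End ℂ H) (M.gr ⊤ 1).subtype))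
    (X : Superfield (d := d) S M A) (k : ℕ) (t : ℝ) :
    endEval c Θ X.toLin k t ∈ degPart H A (1 - k) := by
  refine range_lTensor_induction (fun Θ => endEval c Θ X.toLin k t ∈ degPart H A (1 - k)) hdeg
    (by simp [endEval]) (fun e f hf => ?_) fun x y hx hy => ?_
  · exact tmul_mem_range_lTensor _ (pathEval_mem X hf k t)
  · rw [endEval, map_add]; exact add_mem hx hy

theorem lTensor_I_smul {F F' : Type*} [AddCommGroup F] [Module ℝ F] [AddCommGroup F'] [Module ℝ F']
    (g : F →ₗ[ℝ] F') (x : Module.End ℂ H ⊗[ℝ] F) :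
    LinearMap.lTensor (Module.End ℂ H) g (Complex.I • x) =
      Complex.I • LinearMap.lTensor (Module.End ℂ H) g x := by
  induction x with
  | zero => simp
  | tmul e f => simp [TensorProduct.smul_tmul']
  | add x y hx hy => rw [smul_add, map_add, hx, hy, map_add, smul_add]

theorem lTensor_mulLeft_comp {F : Type*} [AddCommGroup F] [Module ℝ F] (η : A) (g : F →ₗ[ℝ] A)
    (x : Module.End ℂ H ⊗[ℝ] F) :
    LinearMap.lTensor (Module.End ℂ H) (LinearMap.mulLeft ℝ η ∘ₗ g) x =
      ((1 : Module.End ℂ H) ⊗ₜ[ℝ] η) * LinearMap.lTensor (Module.End ℂ H) g x := by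
  induction x with
  | zero => simp
  | tmul e f => simp
  | add x y hx hy => rw [map_add, hx, hy, map_add, mul_add]

theorem endEval_mul {Θ' : Module.End ℂ H ⊗[ℝ] M.Fun}
    (hdeg : Θ' ∈ LinearMap.range (LinearMap.lTensor (Module.End ℂ H) (M.gr ⊤ 1).subtype))
    (X : Superfield (d := d) S M A) (t : ℝ) :
    endEval c (Θ * Θ') X.toLin 1 t + endEval c Θ X.toLin 1 t * endEval c Θ' X.toLin 0 t =
      endEval c Θ X.toLin 0 t * endEval c Θ' X.toLin 1 t := by
  refine range_lTensor_induction (fun Θ' => endEval c (Θ * Θ') X.toLin 1 t +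
    endEval c Θ X.toLin 1 t * endEval c Θ' X.toLin 0 t =
      endEval c Θ X.toLin 0 t * endEval c Θ' X.toLin 1 t) hdeg
    (by simp [endEval]) (fun e f hf => ?_) fun x y hx hy => ?_
  · induction Θ with
    | zero => simp [endEval]
    | tmul e' f' =>
      simp only [endEval, Algebra.TensorProduct.tmul_mul_tmul, LinearMap.lTensor_tmul,
        ← TensorProduct.tmul_add, pathEval_mul X hf]
    | add x y hx hy =>
      simp only [endEval, add_mul, map_add] at hx hy ⊢
      rw [← hx, ← hy]
      abel
  · simp only [endEval, mul_add, map_add] at hx hy ⊢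
    rw [← hx, ← hy]
    abel

/-- Here `e` stands for `η`, `b` and `w` for the 0- and 1-form components of `Θ`, `D` for the de
Rham term, `D'` for the derivative of `b`, `E` for `QΘ` and `F` for the 1-form component of `Θ²`.
Then `E = -i (b w - w b)`, and `w e = e w` brings `e w b` into the form `w (e b)`. -/
theorem gauge_identity {R : Type*} [Ring R] [Algebra ℂ R] {e b w D D' E F : R}
    (hew : w * e = e * w) (hD : D + D' = 0) (hE : E + Complex.I • F = 0)
    (hF : F + w * b = b * w) :
    Complex.I • (w + e * (D + E)) = Complex.I • w - Complex.I • (e * D') -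
      (Complex.I • (e * b)) * (Complex.I • w) + (Complex.I • w) * (Complex.I • (e * b)) := by
  rw [eq_neg_of_add_eq_zero_left hD, eq_neg_of_add_eq_zero_left hE, eq_sub_of_add_eq hF]
  simp only [smul_mul_assoc, mul_smul_comm, smul_smul, Complex.I_mul_I, mul_add, mul_neg, smul_add,
    smul_neg, mul_sub, smul_sub, neg_smul, one_smul]
  rw [← mul_assoc w e b, hew]
  simp only [mul_assoc]
  abel

theorem endEval_variation (Q : CohomologicalVectorField M) (X : Superfield (d := d) S M A) (η : A)
    (t : ℝ) :
    endEval c Θ (X.toLin + constMul η ∘ₗ aksz Q X) 1 t = endEval c Θ X.toLin 1 t +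
      ((1 : Module.End ℂ H) ⊗ₜ[ℝ] η) * (endEval c Θ (deRhamField X) 1 t +
        endEval c (LinearMap.lTensor (Module.End ℂ H) Q.toLin Θ) X.toLin 1 t) := by
  rw [endEval, pathEval_variation, LinearMap.lTensor_add, LinearMap.add_apply, lTensor_mulLeft_comp,
    LinearMap.lTensor_add, LinearMap.add_apply, LinearMap.lTensor_comp_apply]
  rfl

variable [FiniteDimensional ℂ H]

attribute [local instance] endNormedRing endNormedAlgebra

variable (A H) in
/-- Multiplication by the imaginary unit as a continuous linear map. -/
def smulI : Module.End ℂ H ⊗[ℝ] A →L[ℝ] Module.End ℂ H ⊗[ℝ] A :=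
  LinearMap.toContinuousLinearMap
    { toFun := fun x => Complex.I • x
      map_add' := smul_add _
      map_smul' := fun _ _ => smul_comm _ _ _ }

/-- The map `a ↦ e ⊗ a` as a continuous linear map. -/
def tmulL (e : Module.End ℂ H) : A →L[ℝ] Module.End ℂ H ⊗[ℝ] A :=
  LinearMap.toContinuousLinearMap (TensorProduct.mk ℝ (Module.End ℂ H) A e)

variable [IsManifold (𝓡 d) ∞ S]

theorem contDiff_endEval (hc : ContMDiff 𝓘(ℝ, ℝ) (𝓡 d) ∞ c) {X : ℝ → Superfield (d := d) S M A}
    (hX : IsSmoothCurve X) (k : ℕ) :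
    ContDiff ℝ ∞ fun z : ℝ × ℝ => endEval c Θ (X z.1).toLin k z.2 := by
  induction Θ with
  | zero => simpa [endEval] using contDiff_const
  | tmul e f => exact (tmulL (A := A) e).contDiff.comp (contDiff_pathEval hc hX k f)
  | add x y hx hy =>
    simp only [endEval, map_add] at hx hy ⊢
    exact hx.add hy

theorem contDiff_endEval_path (hc : ContMDiff 𝓘(ℝ, ℝ) (𝓡 d) ∞ c) (X : Superfield (d := d) S M A)
    (k : ℕ) : ContDiff ℝ ∞ fun t => endEval c Θ X.toLin k t := by
  have h : ContDiff ℝ ∞ fun z : ℝ × ℝ => endEval c Θ X.toLin k z.2 :=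
    contDiff_endEval hc (isSmoothCurve_const X) k
  exact h.comp_prodMk_left 0

theorem hasDerivAt_endEval
    (hdeg : Θ ∈ LinearMap.range (LinearMap.lTensor (Module.End ℂ H) (M.gr ⊤ 1).subtype))
    (hc : ContMDiff 𝓘(ℝ, ℝ) (𝓡 d) ∞ c) (X : Superfield (d := d) S M A) (t : ℝ) :
    HasDerivAt (fun t => endEval c Θ X.toLin 0 t) (endEval c Θ (-deRhamField X) 1 t) t := by
  refine range_lTensor_induction (fun Θ => HasDerivAt (fun t => endEval c Θ X.toLin 0 t)
    (endEval c Θ (-deRhamField X) 1 t) t) hdeg ?_ (fun e f hf => ?_) fun x y hx hy => ?_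
  · simpa [endEval] using hasDerivAt_const t _
  · exact (tmulL (A := A) e).hasFDerivAt.comp_hasDerivAt t (hasDerivAt_pathEval hc X hf t)
  · simp only [endEval, map_add] at hx hy ⊢
    exact hx.add hy

end Connection

/-! ## The generalized Wilson loop -/

section WilsonLoop

/-! ### The loop as a smooth periodic path. -/

section LoopPath

variable {S : Type*}

theorem loopPath_add_one (γ : Circle → S) (p : Circle) (t : ℝ) :
    loopPath γ p (t + 1) = loopPath γ p t := by
  rw [loopPath, loopPath, mul_add, mul_one, Circle.exp_add_two_pi]

theorem exists_loopPath_eq_shift (γ : Circle → S) (p q : Circle) :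
    ∃ τ : ℝ, 0 ≤ τ ∧ loopPath γ q = fun t => loopPath γ p (t + τ) := by
  obtain ⟨x, hx⟩ : ∃ x : ℝ, Circle.exp x = p⁻¹ * q := ⟨_, Circle.exp_arg _⟩
  -- Adding `n` full turns makes the shift nonnegative, as rounding `N * τ` to a natural number
  -- requires.
  obtain ⟨n, hn⟩ := exists_nat_gt (-(x / (2 * Real.pi)))
  have hpi := Real.pi_pos
  refine ⟨x / (2 * Real.pi) + n, by linarith, funext fun t => ?_⟩
  have e : 2 * Real.pi * (t + (x / (2 * Real.pi) + n)) =
      (2 * Real.pi * t + x) + n * (2 * Real.pi) := by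
    field_simp
    ring
  have hper : Circle.exp ((2 * Real.pi * t + x) + n * (2 * Real.pi)) =
      Circle.exp (2 * Real.pi * t + x) := Circle.periodic_exp.nat_mul n _
  rw [loopPath, loopPath, e, hper, Circle.exp_add, hx, mul_comm (Circle.exp _), ← mul_assoc,
    ← mul_assoc, mul_inv_cancel, one_mul]

variable {d : ℕ} [TopologicalSpace S] [ChartedSpace (EuclideanSpace ℝ (Fin d)) S]

theorem contMDiff_loopPath {γ : Circle → S} (hγ : ContMDiff (𝓡 1) (𝓡 d) ∞ γ) (p : Circle) :
    ContMDiff 𝓘(ℝ, ℝ) (𝓡 d) ∞ (loopPath γ p) := by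
  have h1 : ContMDiff 𝓘(ℝ, ℝ) 𝓘(ℝ, ℝ) ∞ fun t : ℝ => 2 * Real.pi * t :=
    (contDiff_const.mul contDiff_id).contMDiff
  have h2 : ContMDiff 𝓘(ℝ, ℝ) (𝓡 1) ∞ fun t : ℝ => Circle.exp (2 * Real.pi * t) :=
    contMDiff_circleExp.comp h1
  exact hγ.comp (contMDiff_const.mul h2)

end LoopPath

variable {d : ℕ} {S : Type*} [TopologicalSpace S] [ChartedSpace (EuclideanSpace ℝ (Fin d)) S]
  {M : GradedManifold.{u}} {A : ParamAlgebra} {H : Type*} [AddCommGroup H] [Module ℂ H]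
  {γ : Circle → S} {Θ : Module.End ℂ H ⊗[ℝ] M.Fun}

theorem endEval_loopPath_periodic (hγ : ContMDiff (𝓡 1) (𝓡 d) ∞ γ) (p : Circle)
    (Y : M.Fun →ₗ[ℝ] Form (d := d) S A) (k : ℕ) :
    Function.Periodic (endEval (loopPath γ p) Θ Y k) 1 := fun t => by
  have h := pathEval_comp_add ((contMDiff_loopPath hγ p).mdifferentiable (by simp)) Y k 1 t
  rw [endEval, ← h, endEval, show (fun t => loopPath γ p (t + 1)) = loopPath γ p from
    funext (loopPath_add_one γ p)]

theorem endEval_one_mem {c : ℝ → S}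
    (hdeg : Θ ∈ LinearMap.range (LinearMap.lTensor (Module.End ℂ H) (M.gr ⊤ 1).subtype))
    (X : Superfield (d := d) S M A) (t : ℝ) : endEval c Θ X.toLin 1 t ∈ degPart H A 0 := by
  simpa using endEval_mem (c := c) hdeg X 1 t

variable {Q : CohomologicalVectorField M}

/-- Along the cohomological vector field the connection changes by an infinitesimal gauge
transformation. -/
theorem I_smul_endEval_variation {c : ℝ → S}
    (hdeg : Θ ∈ LinearMap.range (LinearMap.lTensor (Module.End ℂ H) (M.gr ⊤ 1).subtype))
    (hΘ : LinearMap.lTensor (Module.End ℂ H) Q.toLin Θ + Complex.I • (Θ * Θ) = 0)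
    (X : Superfield (d := d) S M A) {η : A} (hη : η ∈ A.gr (-1)) (t : ℝ) :
    Complex.I • endEval c Θ (X.toLin + constMul η ∘ₗ aksz Q X) 1 t =
      Complex.I • endEval c Θ X.toLin 1 t -
        Complex.I • (((1 : Module.End ℂ H) ⊗ₜ[ℝ] η) * endEval c Θ (-deRhamField X) 1 t) -
        (Complex.I • (((1 : Module.End ℂ H) ⊗ₜ[ℝ] η) * endEval c Θ X.toLin 0 t)) *
          (Complex.I • endEval c Θ X.toLin 1 t) +
        (Complex.I • endEval c Θ X.toLin 1 t) *
          (Complex.I • (((1 : Module.End ℂ H) ⊗ₜ[ℝ] η) * endEval c Θ X.toLin 0 t)) := by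
  rw [endEval_variation]
  refine gauge_identity (F := endEval c (Θ * Θ) X.toLin 1 t)
    (tmul_mul_comm_of_even hη (endEval_one_mem hdeg X t)) ?_ ?_ (endEval_mul hdeg X t)
  · have h : pathEval c (deRhamField X) 1 t + pathEval c (-deRhamField X) 1 t = 0 := by
      ext f
      exact add_neg_cancel _
    rw [endEval, endEval, ← LinearMap.add_apply, ← LinearMap.lTensor_add, h]
    simp
  · have h := congrArg (LinearMap.lTensor (Module.End ℂ H) (pathEval c X.toLin 1 t)) hΘ
    rw [map_add, map_zero, lTensor_I_smul] at h
    exact h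

variable [IsManifold (𝓡 d) ∞ S] [FiniteDimensional ℂ H]

attribute [local instance] endNormedRing endNormedAlgebra

theorem continuous_I_smul_endEval (hγ : ContMDiff (𝓡 1) (𝓡 d) ∞ γ) (p : Circle)
    (X : Superfield (d := d) S M A) (k : ℕ) :
    Continuous fun t => Complex.I • endEval (loopPath γ p) Θ X.toLin k t :=
  (smulI A H).continuous.comp (contDiff_endEval_path (contMDiff_loopPath hγ p) X k).continuous

theorem wilsonLoop_eq (hγ : ContMDiff (𝓡 1) (𝓡 d) ∞ γ) (p : Circle)
    (X : Superfield (d := d) S M A) :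
    wilsonLoop Θ γ p A X.toLin = partialTrace H A
      (eulerLim fun t => Complex.I • endEval (loopPath γ p) Θ X.toLin 1 t) := by
  rw [wilsonLoop, loopIntegrand_eq, pathExp_eq_eulerLim (continuous_I_smul_endEval hγ p X 1)]
  rfl

theorem exists_finTendsto_orderedProduct (hγ : ContMDiff (𝓡 1) (𝓡 d) ∞ γ) (p : Circle)
    (X : Superfield (d := d) S M A) :
    ∃ W, FinTendsto (orderedProduct (loopIntegrand Θ γ p A X.toLin)) W :=
  ⟨_, finTendsto_orderedProduct (continuous_I_smul_endEval hγ p X 1)⟩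

theorem wilsonLoop_eq_of_basePoint (hγ : ContMDiff (𝓡 1) (𝓡 d) ∞ γ)
    (hdeg : Θ ∈ LinearMap.range (LinearMap.lTensor (Module.End ℂ H) (M.gr ⊤ 1).subtype))
    (p q : Circle) (X : Superfield (d := d) S M A) :
    wilsonLoop Θ γ p A X.toLin = wilsonLoop Θ γ q A X.toLin := by
  have : CompleteSpace (Module.End ℂ H ⊗[ℝ] A) := FiniteDimensional.complete ℝ _
  rw [wilsonLoop_eq hγ, wilsonLoop_eq hγ]
  obtain ⟨τ, hτ, hq⟩ := exists_loopPath_eq_shift γ p q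
  have hu : (fun t => Complex.I • endEval (loopPath γ q) Θ X.toLin 1 t) =
      fun t => (fun t => Complex.I • endEval (loopPath γ p) Θ X.toLin 1 t) (t + τ) := by
    funext t
    simp only [endEval]
    rw [hq, pathEval_comp_add ((contMDiff_loopPath hγ p).mdifferentiable (by simp))]
  -- Testing against real functionals replaces the target `ℂ ⊗ A`, on which no topology has been
  -- chosen, by `ℝ`.
  rw [hu, ← sub_eq_zero, ← Module.forall_dual_apply_eq_zero_iff ℝ]
  intro l
  rw [map_sub, sub_eq_zero]
  refine (trace_eulerLim_shift (s := degZero H A) (T := fun x => l (partialTrace H A x))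
    (l ∘ₗ partialTrace H A).continuous_of_finiteDimensional
    (fun x hx y hy => by rw [partialTrace_mul_comm hx hy])
    (continuous_I_smul_endEval hγ p X 1) (fun t => ?_) (fun r t => ?_) hτ).symm
  · rw [endEval_loopPath_periodic hγ p]
  · exact add_mem (one_mem _)
      (Subalgebra.smul_mem _ (I_smul_mem_degPart (endEval_one_mem hdeg X t)) _)

/-- The algebra homomorphism `id ⊗ φ` carries the ordered products for `X` to those for `Y`, so
uniqueness of limits identifies the holonomies. -/
theorem wilsonLoop_natural (hγ : ContMDiff (𝓡 1) (𝓡 d) ∞ γ) (p : Circle) {B : ParamAlgebra}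
    (φ : A →ₐ[ℝ] B) (X : Superfield (d := d) S M A) (Y : Superfield (d := d) S M B)
    (h : ∀ f k x v, Y.toLin f k x v = φ (X.toLin f k x v)) :
    wilsonLoop Θ γ p B Y.toLin =
      LinearMap.lTensor ℂ φ.toLinearMap (wilsonLoop Θ γ p A X.toLin) := by
  rw [wilsonLoop_eq hγ, wilsonLoop_eq hγ, ← partialTrace_lTensor]
  congr 1
  have hX := (finTendsto_orderedProduct (continuous_I_smul_endEval (Θ := Θ) hγ p X 1)).map
    (LinearMap.lTensor (Module.End ℂ H) φ.toLinearMap)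
  have hY := finTendsto_orderedProduct (continuous_I_smul_endEval (Θ := Θ) hγ p Y 1)
  have hw : (fun t => LinearMap.lTensor (Module.End ℂ H) φ.toLinearMap
      (endEval (loopPath γ p) Θ X.toLin 1 t)) = endEval (loopPath γ p) Θ Y.toLin 1 := by
    funext t
    rw [endEval, endEval, ← LinearMap.lTensor_comp_apply]
    congr 2
    ext f
    exact (h f 1 _ _).symm
  simp only [lTensor_orderedProduct, hw] at hX
  exact hY.unique hX

theorem contDiff_wilsonLoop (hγ : ContMDiff (𝓡 1) (𝓡 d) ∞ γ) (p : Circle)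
    {X : ℝ → Superfield (d := d) S M A} (hX : IsSmoothCurve X) (l : ℂ ⊗[ℝ] A →ₗ[ℝ] ℝ) :
    ContDiff ℝ ∞ fun s => l (wilsonLoop Θ γ p A (X s).toLin) := by
  have : CompleteSpace (Module.End ℂ H ⊗[ℝ] A) := FiniteDimensional.complete ℝ _
  simp only [wilsonLoop_eq hγ]
  have hu : ContDiff ℝ ∞ fun z : ℝ × ℝ =>
      Complex.I • endEval (loopPath γ p) Θ (X z.1).toLin 1 z.2 :=
    (contDiff_endEval (contMDiff_loopPath hγ p) hX 1).linearMap_comp (smulI A H).toLinearMap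
  exact (contDiff_eulerLim hu).linearMap_comp (l ∘ₗ partialTrace H A)

theorem wilsonLoop_mem (hγ : ContMDiff (𝓡 1) (𝓡 d) ∞ γ)
    (hdeg : Θ ∈ LinearMap.range (LinearMap.lTensor (Module.End ℂ H) (M.gr ⊤ 1).subtype))
    (p : Circle) (X : Superfield (d := d) S M A) :
    wilsonLoop Θ γ p A X.toLin ∈ LinearMap.range (LinearMap.lTensor ℂ (A.gr 0).subtype) := by
  rw [wilsonLoop_eq hγ]
  exact partialTrace_mem (eulerLim_mem_degZero (continuous_I_smul_endEval hγ p X 1)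
    fun t => endEval_one_mem hdeg X t)

/-- The holonomy is conjugated by `1 + B 0`, because the gauge parameter takes the same value at
both ends of the loop; the trace in degree 0 is invariant under this. -/
theorem wilsonLoop_closed (hγ : ContMDiff (𝓡 1) (𝓡 d) ∞ γ)
    (hdeg : Θ ∈ LinearMap.range (LinearMap.lTensor (Module.End ℂ H) (M.gr ⊤ 1).subtype))
    (hΘ : LinearMap.lTensor (Module.End ℂ H) Q.toLin Θ + Complex.I • (Θ * Θ) = 0) (p : Circle)
    (X : Superfield (d := d) S M A) {η : A} (hη : η ∈ A.gr (-1)) :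
    wilsonLoop Θ γ p A (X.toLin + constMul η ∘ₗ aksz Q X) = wilsonLoop Θ γ p A X.toLin := by
  have : CompleteSpace (Module.End ℂ H ⊗[ℝ] A) := FiniteDimensional.complete ℝ _
  have hc := contMDiff_loopPath hγ p
  set c := loopPath γ p with hcdef
  set e : Module.End ℂ H ⊗[ℝ] A := (1 : Module.End ℂ H) ⊗ₜ[ℝ] η with he
  set u : ℝ → Module.End ℂ H ⊗[ℝ] A := fun t => Complex.I • endEval c Θ X.toLin 1 t with hu
  set B : ℝ → Module.End ℂ H ⊗[ℝ] A := fun t => Complex.I • (e * endEval c Θ X.toLin 0 t) with hB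
  set B' : ℝ → Module.End ℂ H ⊗[ℝ] A :=
    fun t => Complex.I • (e * endEval c Θ (-deRhamField X) 1 t) with hB'
  have huc : Continuous u := continuous_I_smul_endEval hγ p X 1
  have hb := fun t => hasDerivAt_endEval hdeg hc X t
  have hBd : ∀ t, HasDerivAt B (B' t) t := fun t =>
    (smulI A H).hasFDerivAt.comp_hasDerivAt t ((hb t).const_mul e)
  -- Continuity of this term is inherited from the smooth 0-form component, whose derivative it is.
  have hb'c : Continuous fun t => endEval c Θ (-deRhamField X) 1 t := by
    rw [show (fun t => endEval c Θ (-deRhamField X) 1 t) =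
      deriv fun t => endEval c Θ X.toLin 0 t from funext fun t => (hb t).deriv.symm]
    exact (contDiff_endEval_path hc X 0).continuous_deriv (by simp)
  have hB'c : Continuous B' := (smulI A H).continuous.comp (continuous_const.mul hb'c)
  have hBc : Continuous B := continuous_iff_continuousAt.2 fun t => (hBd t).continuousAt
  have hb1 : ∀ t, endEval c Θ X.toLin 0 t ∈ degPart H A 1 := fun t => by
    simpa using endEval_mem (c := c) hdeg X 0 t
  have hu0 : ∀ t, u t ∈ degPart H A 0 := fun t => I_smul_mem_degPart (endEval_one_mem hdeg X t)
  have hnew : (fun t => Complex.I • endEval c Θ (X.toLin + constMul η ∘ₗ aksz Q X) 1 t) =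
      fun t => u t - B' t - B t * u t + u t * B t :=
    funext fun t => I_smul_endEval_variation hdeg hΘ X hη t
  have hBB : ∀ s t, B s * B t = 0 := fun s t => by
    simp only [hB, smul_mul_assoc, mul_smul_comm]
    rw [← mul_assoc, tmul_mul_mul_tmul_eq_zero hη (hb1 s)]
    simp
  have hBuB : ∀ s r t, B s * u r * B t = 0 := fun s r t => by
    simp only [hB, smul_mul_assoc, mul_smul_comm]
    rw [mul_assoc e, ← mul_assoc (e * _), tmul_mul_mul_tmul_eq_zero hη
      (by simpa using mul_mem_degPart (hb1 s) (hu0 r))]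
    simp
  have hper : B 1 = B 0 := by
    have := endEval_loopPath_periodic (Θ := Θ) hγ p X.toLin 0 0
    rw [zero_add] at this
    simp only [hB, hcdef, this]
  have hB0 : B 0 ∈ degZero H A := by
    refine I_smul_mem_degPart (n := 0) ?_
    have : e ∈ degPart H A (-1) := tmul_mem_range_lTensor _ hη
    simpa using mul_mem_degPart this (hb1 0)
  have hW := eulerLim_mem_degZero huc fun t => endEval_one_mem hdeg X t
  have hcont : Continuous fun t =>
      Complex.I • endEval c Θ (X.toLin + constMul η ∘ₗ aksz Q X) 1 t := by
    rw [hnew]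
    exact ((huc.sub hB'c).sub (hBc.mul huc)).add (huc.mul hBc)
  -- The varied field is given only as a linear map, not as a `Superfield`, so its loop is unfolded
  -- by hand, using the continuity of the transformed path.
  rw [wilsonLoop_eq hγ, wilsonLoop, loopIntegrand_eq, pathExp_eq_eulerLim hcont, hnew,
    eulerLim_gauge huc hBd hB'c hBB hBuB, hper]
  refine (partialTrace_mul_comm (mul_mem (sub_mem (one_mem _) hB0) hW)
    (add_mem (one_mem _) hB0)).trans ?_
  have hinv : (1 + B 0) * (1 - B 0) = 1 := by
    rw [mul_sub, mul_one, add_mul, one_mul, hBB, add_zero, add_sub_cancel_right]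
  rw [← mul_assoc, hinv, one_mul]

end WilsonLoop
end

theorem proposition5
    (M : GradedManifold) (Q : CohomologicalVectorField M)
    {d : ℕ} {S : Type*} [TopologicalSpace S] [ChartedSpace (EuclideanSpace ℝ (Fin d)) S]
    [IsManifold (𝓡 d) ∞ S]
    (γ : Circle → S) (hγ : ContMDiff (𝓡 1) (𝓡 d) ∞ γ)
    {H : Type*} [AddCommGroup H] [Module ℂ H] [FiniteDimensional ℂ H]
    (Θ : Module.End ℂ H ⊗[ℝ] M.Fun)
    (hdeg : Θ ∈ LinearMap.range (LinearMap.lTensor (Module.End ℂ H) (M.gr ⊤ 1).subtype))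
    (hΘ : LinearMap.lTensor (Module.End ℂ H) Q.toLin Θ + Complex.I • (Θ * Θ) = 0) :
    (∀ (p : Circle) (A : ParamAlgebra) (X : Superfield (d := d) S M A),
      ∃ W, FinTendsto (orderedProduct (loopIntegrand Θ γ p A X.toLin)) W) ∧
    (∀ (p q : Circle) (A : ParamAlgebra) (X : Superfield (d := d) S M A),
      wilsonLoop Θ γ p A X.toLin = wilsonLoop Θ γ q A X.toLin) ∧
    ∀ p : Circle, IsObservable (S := S) (d := d) Q (wilsonLoop Θ γ p) :=
  ⟨fun p _ X => exists_finTendsto_orderedProduct hγ p X,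
    fun p q _ X => wilsonLoop_eq_of_basePoint hγ hdeg p q X,
    fun p =>
      { natural := fun _ _ φ _ X Y h => wilsonLoop_natural hγ p φ X Y h
        smooth := fun _ _ hX l => contDiff_wilsonLoop hγ p hX l
        degree_zero := fun _ X => wilsonLoop_mem hγ hdeg p X
        closed := fun _ X _ hη => wilsonLoop_closed hγ hdeg hΘ p X hη }⟩
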